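/- All graphs are finite loopless multigraphs, possibly with parallel edges. A divisor on a graph $H$ is a function $D\colon V(H)\to\mathbb Z$; its degree is $\deg(D)=\sum_v D(v)$, and $D$ is effective if $D\ge 0$. Two divisors are equivalent if they differ by $L\sigma$ for some $\sigma\in\mathbb Z^{V(H)}$, where $L$ is the Laplacian matrix of $H$. The rank of $D$ is $-1$ if $D$ is not equivalent to an effective divisor, and otherwise the largest $k\ge 0$ such that $D-F$ is equivalent to an effective divisor for every effective divisor $F$ of degree $k$. For $r\ge 1$, $\mathrm{dgon}_r(H)$ is the minimum degree of a divisor of rank $r$ on $H$. The independence number of $G$ is denoted $\alpha(G)$, and $G$ is subcubic if every vertex is incident to at most three edges. For a graph $G=(V,E)$ and $r\ge 1$ put $M=r(3|V|+2|E|+1)+1$. The graph $G'_r$ has a vertex $T$, three vertices $v,v',T_v$ for each $v\in V$, and two vertices $e_u,e_v$ for each edge $e\in E$ with endpoints $u,v$. Its edges are: $M$ edges between $T$ and $T_v$, $M$ edges between $v$ and $v'$, and $r+2$ edges between $v'$ and $T_v$, for each $v\in V$; and $M$ edges between $u$ and $e_u$, $M$ edges between $v$ and $e_v$, and $r$ edges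 between $e_u$ and $e_v$, for each edge $e\in E$ with endpoints $u,v$. **Lemma.** There is an algorithm (a random access machine program, with logarithmic cost) with the following property. Let $r\ge 1$, let $G$ be a subcubic graph, let $\varepsilon\in\mathbb R$, and let $D$ be an effective divisor on $G'_r$ of rank at least $r$ with $$\deg(D)\le(1+\varepsilon)\,\mathrm{dgon}_r(G'_r).$$ Then, given $r$, $G$ and $D$ (with all numbers in binary), the algorithm constructs an independent set of $G$ of size at least $$\bigl(1-(25r-3)\varepsilon\bigr)\,\alpha(G)$$ in time at most $p(r+\ell)$, where $p$ is a fixed polynomial and $\ell$ is the bit length of the input. In particular, for each fixed $r$ the running time is polynomial in the bit length of $(G,D)$. -/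

import Mathlib

/-! ## Multigraphs -/

/-- A loopless multigraph with vertex type `V` and edge type `E` (parallel edges allowed).
The two endpoints of an edge `e` are `ends e false` and `ends e true`; their order is only a way to
name them and carries no meaning. -/
structure Multigraph (V E : Type) where
  ends : E → Bool → V
  loopless : ∀ e, ends e false ≠ ends e true

/-- A divisor on a graph with finite vertex type `V`. -/
abbrev Divisor (V : Type) : Type := V → ℤ

namespace Divisor

/-- The total number of chips. -/
def deg {V : Type} [Fintype V] (D : Divisor V) : ℤ := ∑ v, D v

/-- No vertex is in debt. -/
def Effective {V : Type} (D : Divisor V) : Prop := ∀ v, 0 ≤ D v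

end Divisor

namespace Multigraph

variable {V E : Type} [Fintype V] [DecidableEq V] [Fintype E]

/-- The set `E(v, w)` of edges connecting `v` and `w`. -/
def edgesBetween (G : Multigraph V E) (v w : V) : Finset E :=
  Finset.univ.filter fun e => ∃ b, G.ends e b = v ∧ G.ends e (!b) = w

/-- The number of edges incident to `v`. -/
def valence (G : Multigraph V E) (v : V) : ℕ :=
  (Finset.univ.filter fun e => ∃ b, G.ends e b = v).card

/-- Every vertex has valence at most three. -/
def IsSubcubic (G : Multigraph V E) : Prop := ∀ v, G.valence v ≤ 3

/-- No two elements of `S` are connected by an edge. -/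
def IsIndependent (G : Multigraph V E) (S : Finset V) : Prop :=
  ∀ v ∈ S, ∀ w ∈ S, G.edgesBetween v w = ∅

/-- The independence number `α(G)`. -/
noncomputable def indepNumber (G : Multigraph V E) : ℕ :=
  sSup {k : ℕ | ∃ S : Finset V, G.IsIndependent S ∧ S.card = k}

/-- The Laplacian matrix. -/
def laplacian (G : Multigraph V E) : Matrix V V ℤ :=
  Matrix.of fun v w => if v = w then (G.valence v : ℤ) else -((G.edgesBetween v w).card : ℤ)

/-- Equivalence of divisors: `D' = D - Lσ` for some integral firing script `σ`. -/
def Equivalent (G : Multigraph V E) (D D' : Divisor V) : Prop :=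
  ∃ σ : V → ℤ, D' = D - G.laplacian.mulVec σ

/-- The set `|D|` of all effective divisors equivalent to `D`. -/
def linearSystem (G : Multigraph V E) (D : Divisor V) : Set (Divisor V) :=
  {D' | G.Equivalent D D' ∧ D'.Effective}

open Classical in
/-- The rank of a divisor: `-1` if `|D|` is empty, and otherwise the largest `k` such that
`|D - F|` is non-empty for all effective divisors `F` of degree `k`. -/
noncomputable def rank (G : Multigraph V E) (D : Divisor V) : ℤ :=
  if G.linearSystem D = ∅ then -1
  else ((sSup {k : ℕ | ∀ F : Divisor V, F.Effective → F.deg = (k : ℤ) →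
    (G.linearSystem (D - F)).Nonempty} : ℕ) : ℤ)

/-- The `r`-th divisorial gonality: the minimum degree of a divisor of rank `r`. -/
noncomputable def dgon (G : Multigraph V E) (r : ℕ) : ℤ :=
  sInf {d : ℤ | ∃ D : Divisor V, G.rank D = (r : ℤ) ∧ D.deg = d}

end Multigraph

/-! ## The graph `G'_r` -/

/-- The vertices of `G'_r`: one vertex `T`; three vertices `v`, `v'`, `T_v` for each vertex `v` of
`G`; and two vertices for each edge `e` of `G`, one for each endpoint of `e`. -/
inductive AuxVertex (V E : Type) : Type where
  | top : AuxVertex V E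
  | orig (v : V) : AuxVertex V E
  | prime (v : V) : AuxVertex V E
  | tip (v : V) : AuxVertex V E
  | edgeEnd (e : E) (b : Bool) : AuxVertex V E
  deriving DecidableEq, Fintype

/-- The edges of `G'_r`, where `M` is the number of edges in a large bundle: `M` edges between `T`
and `T_v`, `M` edges between `v` and `v'`, `r + 2` edges between `v'` and `T_v`, `M` edges between
an endpoint `v` of `e` and `e_v`, and `r` edges between the two vertices that belong to `e`. -/
inductive AuxEdge (V E : Type) (r M : ℕ) : Type where
  | topTip (v : V) (k : Fin M) : AuxEdge V E r M
  | origPrime (v : V) (k : Fin M) : AuxEdge V E r M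
  | primeTip (v : V) (k : Fin (r + 2)) : AuxEdge V E r M
  | origEnd (e : E) (b : Bool) (k : Fin M) : AuxEdge V E r M
  | link (e : E) (k : Fin r) : AuxEdge V E r M
  deriving DecidableEq, Fintype

namespace Multigraph

/-- The number `M = r (3|V| + 2|E| + 1) + 1`. -/
def bundleSize (V E : Type) [Fintype V] [Fintype E] (r : ℕ) : ℕ :=
  r * (3 * Fintype.card V + 2 * Fintype.card E + 1) + 1

/-- The graph `G'_r`. -/
def aux {V E : Type} [Fintype V] [Fintype E] (G : Multigraph V E) (r : ℕ) :
    Multigraph (AuxVertex V E) (AuxEdge V E r (bundleSize V E r)) where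
  ends
    | .topTip v _, b => bif b then .tip v else .top
    | .origPrime v _, b => bif b then .prime v else .orig v
    | .primeTip v _, b => bif b then .tip v else .prime v
    | .origEnd e c _, b => bif b then .edgeEnd e c else .orig (G.ends e c)
    | .link e _, b => .edgeEnd e b
  loopless e := by cases e <;> simp

end Multigraph

/-! ## A random access machine with logarithmic cost

Programs are structured programs over natural-number variables and arrays (memories), both named
by natural numbers. Every evaluation of a subexpression costs one plus the bit length of its
value, so that numbers and memory addresses are charged by their length. -/

namespace RAM

/-- Expressions. Subtraction is truncated; `lt` has value `1` or `0`. -/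
inductive Expr : Type where
  | lit (k : ℕ) : Expr
  | var (x : ℕ) : Expr
  | read (a : ℕ) (i : Expr) : Expr
  | add (e f : Expr) : Expr
  | sub (e f : Expr) : Expr
  | mul (e f : Expr) : Expr
  | lt (e f : Expr) : Expr

/-- Programs. Conditions are expressions, with zero read as false and any other value as true. -/
inductive Prog : Type where
  | skip : Prog
  | assign (x : ℕ) (e : Expr) : Prog
  | write (a : ℕ) (i e : Expr) : Prog
  | seq (p q : Prog) : Prog
  | ite (e : Expr) (p q : Prog) : Prog
  | while (e : Expr) (p : Prog) : Prog

/-- The contents of the variables and of the arrays. -/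
structure State : Type where
  var : ℕ → ℕ
  arr : ℕ → ℕ → ℕ

/-- The value of an expression. -/
def Expr.eval (s : State) : Expr → ℕ
  | .lit k => k
  | .var x => s.var x
  | .read a i => s.arr a (i.eval s)
  | .add e f => e.eval s + f.eval s
  | .sub e f => e.eval s - f.eval s
  | .mul e f => e.eval s * f.eval s
  | .lt e f => if e.eval s < f.eval s then 1 else 0

/-- The logarithmic cost of evaluating an expression. -/
def Expr.cost (s : State) : Expr → ℕ
  | .lit k => 1 + k.size
  | .var x => 1 + (s.var x).size
  | .read a i => i.cost s + (1 + (s.arr a (i.eval s)).size)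
  | .add e f => e.cost s + f.cost s + (1 + (e.eval s + f.eval s).size)
  | .sub e f => e.cost s + f.cost s + (1 + (e.eval s - f.eval s).size)
  | .mul e f => e.cost s + f.cost s + (1 + (e.eval s * f.eval s).size)
  | .lt e f => e.cost s + f.cost s + 2

/-- Store `k` in the variable `x`. -/
def State.setVar (s : State) (x k : ℕ) : State :=
  { s with var := Function.update s.var x k }

/-- Store `k` in the cell with address `i` of the array `a`. -/
def State.setArr (s : State) (a i k : ℕ) : State :=
  { s with arr := Function.update s.arr a (Function.update (s.arr a) i k) }

/-- `Exec p s s' t`: started in the state `s`, the program `p` halts in the state `s'` at total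
cost `t`. -/
inductive Exec : Prog → State → State → ℕ → Prop where
  | skip (s : State) : Exec .skip s s 1
  | assign (s : State) (x : ℕ) (e : Expr) :
      Exec (.assign x e) s (s.setVar x (e.eval s)) (e.cost s + 1)
  | write (s : State) (a : ℕ) (i e : Expr) :
      Exec (.write a i e) s (s.setArr a (i.eval s) (e.eval s)) (i.cost s + e.cost s + 1)
  | seq {p q : Prog} {s s' s'' : State} {t t' : ℕ} :
      Exec p s s' t → Exec q s' s'' t' → Exec (.seq p q) s s'' (t + t')
  | ite_true {e : Expr} {p q : Prog} {s s' : State} {t : ℕ} :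
      e.eval s ≠ 0 → Exec p s s' t → Exec (.ite e p q) s s' (e.cost s + 1 + t)
  | ite_false {e : Expr} {p q : Prog} {s s' : State} {t : ℕ} :
      e.eval s = 0 → Exec q s s' t → Exec (.ite e p q) s s' (e.cost s + 1 + t)
  | while_true {e : Expr} {p : Prog} {s s' s'' : State} {t t' : ℕ} :
      e.eval s ≠ 0 → Exec p s s' t → Exec (.while e p) s' s'' t' →
      Exec (.while e p) s s'' (e.cost s + 1 + t + t')
  | while_false {e : Expr} {p : Prog} {s : State} :
      e.eval s = 0 → Exec (.while e p) s s (e.cost s + 1)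

/-- The initial state: the input is in array `0`, its length in variable `0`, all else is zero. -/
def initial (input : List ℕ) : State where
  var x := if x = 0 then input.length else 0
  arr a i := if a = 0 then input.getD i 0 else 0

/-- The output of a state: the first cells of array `1`, their number being in variable `1`. -/
def State.output (s : State) : List ℕ := (List.range (s.var 1)).map (s.arr 1)

/-- On the given input, `p` halts with the given output at total cost `t`. -/
def Prog.Computes (p : Prog) (input output : List ℕ) (t : ℕ) : Prop :=
  ∃ s, Exec p (initial input) s t ∧ s.output = output

/-- The bit length of a list of natural numbers, with one separating symbol for each entry. -/
def bitLength (l : List ℕ) : ℕ := (l.map fun k => k.size + 1).sum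

end RAM

/-! ## Input and output of the algorithm -/

/-- The encoding of `r`, of a graph `G` with vertices `0, …, n - 1` and edges `0, …, m - 1`, and of
an effective divisor `D` on `G'_r`: the numbers `r`, `n`, `m`, the endpoints of the edges, and the
numbers of chips on the vertices of `G'_r`. (Chip counts are natural numbers as `D` is effective.) -/
def encodeInstance (r : ℕ) {n m : ℕ} (G : Multigraph (Fin n) (Fin m))
    (D : Divisor (AuxVertex (Fin n) (Fin m))) : List ℕ :=
  [r, n, m] ++
    (List.ofFn fun e : Fin m => (G.ends e false : ℕ)) ++
    (List.ofFn fun e : Fin m => (G.ends e true : ℕ)) ++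
    [(D .top).toNat] ++
    (List.ofFn fun v : Fin n => (D (.orig v)).toNat) ++
    (List.ofFn fun v : Fin n => (D (.prime v)).toNat) ++
    (List.ofFn fun v : Fin n => (D (.tip v)).toNat) ++
    (List.ofFn fun e : Fin m => (D (.edgeEnd e false)).toNat) ++
    (List.ofFn fun e : Fin m => (D (.edgeEnd e true)).toNat)

/-- A set of vertices, encoded by its indicator vector. -/
def encodeVertexSet {n : ℕ} (S : Finset (Fin n)) : List ℕ :=
  List.ofFn fun v : Fin n => if v ∈ S then 1 else 0

set_option linter.unusedSectionVars false

/-! Write `n`, `m` for the numbers of vertices and edges of `G`, `α` for its independence number,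
`M` for the bundle size, and `K = (3r+1)n + (2r-1)m + r`. The proof compares two bounds around `K`.

If an effective divisor has degree less than `M`, every script leading from it to an effective
divisor is constant along the large bundles (`bundleConstant_of_deg_lt`). Such a script assigns one
integer to `T` and its tips and one to each vertex of `G`. Chips then move only between `v'` and
`T_v`, in multiples of `r+2`, and between `e_u` and `e_v`, in multiples of `r`.

Lower bound (`le_card_candidates`): if the rank is at least `r`, then `T` and each `v` hold at least
`r` chips, each pair `v'`, `T_v` at least `2r`, and each pair `e_u`, `e_v` at least `2r-1`. A pair
`v'`, `T_v` with only `2r` chips is `(r, r)` and frozen. If both ends of `e` are frozen, no chips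
cross `e`, and its pair needs `2r` chips. So if `A` is the set of frozen vertices, `|A|` minus the
number of edges inside `A` is at least `K - deg D`. Deleting one endpoint of each remaining inner
edge of `A` gives an independent set `S` with `|S| ≥ K - deg D`. For degree at least `M`, `A` is
taken to be all of `V`.

Upper bound (`dgon_aux_le`): a maximum independent set yields a divisor of rank at least `r` and
degree `K - α`, so `dgon ≤ K - α`. Hence `|S| ≥ α - ε·dgon`, and `n ≤ 4α`, `2m ≤ 3n` give `dgon ≤
(25r-3)α`.

The program sums the chips, marks the candidates and prunes them, with linearly many steps on
numbers of input length. -/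

namespace Multigraph

/-! ### The Laplacian as a sum over half-edges, and firing across large bundles. -/

section Laplacian

variable {V E : Type} [Fintype V] [DecidableEq V] [Fintype E]

theorem ends_ne (G : Multigraph V E) (e : E) (b : Bool) : G.ends e b ≠ G.ends e (!b) := by
  cases b
  · exact G.loopless e
  · exact (G.loopless e).symm

theorem valence_eq_sum (G : Multigraph V E) (v : V) :
    G.valence v = ∑ e, ∑ b, if G.ends e b = v then 1 else 0 := by
  rw [valence, Finset.card_filter]
  refine Finset.sum_congr rfl fun e _ => ?_
  have h := G.loopless e
  simp only [Fintype.sum_bool, Bool.exists_bool]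
  split_ifs <;> simp_all

theorem card_edgesBetween_eq_sum (G : Multigraph V E) (v w : V) :
    (G.edgesBetween v w).card =
      ∑ e, ∑ b, if G.ends e b = v then (if G.ends e (!b) = w then 1 else 0) else 0 := by
  rw [edgesBetween, Finset.card_filter]
  refine Finset.sum_congr rfl fun e _ => ?_
  have h := G.loopless e
  simp only [Fintype.sum_bool, Bool.exists_bool, Bool.not_true, Bool.not_false]
  split_ifs <;> simp_all

theorem edgesBetween_self (G : Multigraph V E) (v : V) : G.edgesBetween v v = ∅ := by
  refine Finset.filter_eq_empty_iff.2 ?_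
  rintro e - ⟨b, h, h'⟩
  exact G.ends_ne e b (h.trans h'.symm)

/-- In this form parallel edges are counted one by one, so the Laplacian of `G'_r` can be read off
from its list of edge types. -/
theorem laplacian_mulVec_apply (G : Multigraph V E) (σ : V → ℤ) (v : V) :
    G.laplacian.mulVec σ v =
      ∑ e, ∑ b, if G.ends e b = v then σ v - σ (G.ends e (!b)) else 0 := by
  have h : ∀ w, G.laplacian v w * σ w =
      (if v = w then (G.valence v : ℤ) * σ v else 0) - ((G.edgesBetween v w).card : ℤ) * σ w := by
    intro w
    by_cases hvw : v = w
    · subst hvw; simp [laplacian, edgesBetween_self]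
    · simp [laplacian, hvw]
  have h2 : ∑ w, ((G.edgesBetween v w).card : ℤ) * σ w =
      ∑ e, ∑ b, if G.ends e b = v then σ (G.ends e (!b)) else 0 := by
    simp only [card_edgesBetween_eq_sum, Nat.cast_sum, Finset.sum_mul]
    rw [Finset.sum_comm]
    refine Finset.sum_congr rfl fun e _ => ?_
    rw [Finset.sum_comm]
    refine Finset.sum_congr rfl fun b _ => ?_
    split_ifs <;> simp
  simp only [Matrix.mulVec, dotProduct]
  rw [Finset.sum_congr rfl fun w _ => h w, Finset.sum_sub_distrib, h2, Finset.sum_ite_eq,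
    if_pos (Finset.mem_univ _), valence_eq_sum]
  simp only [Nat.cast_sum, Finset.sum_mul]
  rw [← Finset.sum_sub_distrib]
  refine Finset.sum_congr rfl fun e _ => ?_
  rw [← Finset.sum_sub_distrib]
  refine Finset.sum_congr rfl fun b _ => ?_
  split_ifs <;> simp

/-- Green's identity. -/
theorem sum_mul_laplacian_mulVec (G : Multigraph V E) (f σ : V → ℤ) :
    ∑ v, f v * G.laplacian.mulVec σ v =
      ∑ e, (f (G.ends e false) - f (G.ends e true)) *
        (σ (G.ends e false) - σ (G.ends e true)) := by
  simp only [laplacian_mulVec_apply, Finset.mul_sum]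
  rw [Finset.sum_comm]
  refine Finset.sum_congr rfl fun e _ => ?_
  rw [Finset.sum_comm]
  simp only [Fintype.sum_bool, mul_ite, mul_zero, Finset.sum_ite_eq, Finset.mem_univ, if_true,
    Bool.not_true, Bool.not_false]
  ring

theorem Equivalent.deg_eq {G : Multigraph V E} {D D' : Divisor V} (h : G.Equivalent D D') :
    D'.deg = D.deg := by
  obtain ⟨σ, rfl⟩ := h
  have := G.sum_mul_laplacian_mulVec (fun _ => 1) σ
  simp only [one_mul, sub_self, zero_mul, Finset.sum_const_zero] at this
  simp [Divisor.deg, Finset.sum_sub_distrib, this]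

theorem equivalent_refl (G : Multigraph V E) (D : Divisor V) : G.Equivalent D D :=
  ⟨0, by simp⟩

theorem Equivalent.add_right {G : Multigraph V E} {D D' : Divisor V} (h : G.Equivalent D D')
    (F : Divisor V) : G.Equivalent (D + F) (D' + F) := by
  obtain ⟨σ, rfl⟩ := h
  exact ⟨σ, by abel⟩

/-- A firing script between effective divisors is constant along every bundle of edges that is
larger than the degree. -/
theorem le_of_deg_lt_card {G : Multigraph V E} {D : Divisor V} {σ : V → ℤ}
    (hD : D.Effective) (hD' : (D - G.laplacian.mulVec σ : Divisor V).Effective) {a b : V}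
    (hlt : D.deg < (G.edgesBetween a b).card) : σ a ≤ σ b := by
  by_contra! hab
  -- The level set of `σ` at height `σ a` loses at least one chip along every edge that leaves it,
  -- in particular along all edges from `a` to `b`; but it cannot lose more than the degree.
  set f : V → ℤ := fun v => if σ a ≤ σ v then 1 else 0 with hf
  have hnonneg : ∀ e, 0 ≤ (f (G.ends e false) - f (G.ends e true)) *
      (σ (G.ends e false) - σ (G.ends e true)) := by
    intro e
    simp only [hf]
    split_ifs <;> simp <;> omega
  have hge : ∀ e ∈ G.edgesBetween a b, 1 ≤ (f (G.ends e false) - f (G.ends e true)) *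
      (σ (G.ends e false) - σ (G.ends e true)) := by
    intro e he
    obtain ⟨c, rfl, rfl⟩ := (Finset.mem_filter.1 he).2
    cases c <;> simp only [Bool.not_true, Bool.not_false] at hab hf ⊢ <;> simp only [hf] <;>
      rw [if_pos le_rfl, if_neg (not_le.2 hab)] <;> omega
  have h1 : ((G.edgesBetween a b).card : ℤ) ≤ ∑ v, f v * G.laplacian.mulVec σ v := by
    rw [sum_mul_laplacian_mulVec]
    calc ((G.edgesBetween a b).card : ℤ) = ∑ e ∈ G.edgesBetween a b, 1 := by simp
      _ ≤ _ := Finset.sum_le_sum hge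
      _ ≤ _ := Finset.sum_le_sum_of_subset_of_nonneg (Finset.subset_univ _)
          fun e _ _ => hnonneg e
  have h2 : ∑ v, f v * G.laplacian.mulVec σ v ≤ D.deg := by
    refine Finset.sum_le_sum fun v _ => ?_
    have h3 := hD v
    have h4 := hD' v
    simp only [Pi.sub_apply] at h4
    simp only [hf]
    split_ifs <;> omega
  omega

end Laplacian

/-! ### Rank and gonality in terms of `RankAtLeast`. -/

section Rank

variable {V E : Type} [Fintype V] [DecidableEq V] [Fintype E]

/-- Any `k` chips can be removed from `D` without leaving debt, up to equivalence. -/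
def RankAtLeast (G : Multigraph V E) (D : Divisor V) (k : ℕ) : Prop :=
  ∀ F : Divisor V, F.Effective → F.deg = (k : ℤ) → (G.linearSystem (D - F)).Nonempty

theorem effective_single (v : V) {k : ℤ} (hk : 0 ≤ k) :
    Divisor.Effective (Pi.single v k : V → ℤ) := by
  intro w
  by_cases h : w = v
  · subst h; simpa
  · simp [h]

theorem deg_single (v : V) (k : ℤ) : Divisor.deg (Pi.single v k : V → ℤ) = k := by
  simp [Divisor.deg]

theorem deg_nonneg_of_linearSystem_nonempty {G : Multigraph V E} {D : Divisor V}
    (h : (G.linearSystem D).Nonempty) : 0 ≤ D.deg := by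
  obtain ⟨D', h1, h2⟩ := h
  rw [← h1.deg_eq]
  exact Finset.sum_nonneg fun v _ => h2 v

theorem deg_sub (D F : Divisor V) : Divisor.deg (D - F) = D.deg - F.deg := by
  simp [Divisor.deg, Finset.sum_sub_distrib]

theorem RankAtLeast.le_deg [Nonempty V] {G : Multigraph V E} {D : Divisor V} {k : ℕ}
    (h : G.RankAtLeast D k) : (k : ℤ) ≤ D.deg := by
  have v := Classical.arbitrary V
  have := deg_nonneg_of_linearSystem_nonempty
    (h (Pi.single v (k : ℤ)) (effective_single v (by positivity)) (deg_single v _))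
  rw [deg_sub, deg_single] at this
  omega

theorem RankAtLeast.sub_single {G : Multigraph V E} {D : Divisor V} {k : ℕ}
    (h : G.RankAtLeast D (k + 1)) (v : V) : G.RankAtLeast (D - Pi.single v 1) k := by
  intro F hF hk
  have := h (F + Pi.single v 1) (fun w => add_nonneg (hF w) (effective_single v zero_le_one w)) ?_
  · rwa [show D - (F + Pi.single v 1) = D - Pi.single v 1 - F by abel] at this
  · have h1 := deg_single v 1
    simp only [Divisor.deg, Pi.add_apply, Finset.sum_add_distrib] at hk h1 ⊢
    rw [hk, h1]; push_cast; ring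

theorem RankAtLeast.of_succ [Nonempty V] {G : Multigraph V E} {D : Divisor V} {k : ℕ}
    (h : G.RankAtLeast D (k + 1)) : G.RankAtLeast D k := by
  have v := Classical.arbitrary V
  intro F hF hk
  obtain ⟨D', h1, h2⟩ := h.sub_single v F hF hk
  refine ⟨D' + Pi.single v 1, ?_, fun w => add_nonneg (h2 w) (effective_single v zero_le_one w)⟩
  have := h1.add_right (Pi.single v 1)
  rwa [show D - Pi.single v 1 - F + Pi.single v 1 = D - F by abel] at this

theorem RankAtLeast.mono [Nonempty V] {G : Multigraph V E} {D : Divisor V} {j k : ℕ}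
    (h : G.RankAtLeast D k) (hjk : j ≤ k) : G.RankAtLeast D j :=
  Nat.decreasingInduction (motive := fun i _ => G.RankAtLeast D i) (fun _ _ => .of_succ) h hjk

theorem RankAtLeast.linearSystem_nonempty [Nonempty V] {G : Multigraph V E} {D : Divisor V}
    {k : ℕ} (h : G.RankAtLeast D k) : (G.linearSystem D).Nonempty := by
  simpa using h.mono (Nat.zero_le k) 0 (fun _ => le_rfl) (by simp [Divisor.deg])

theorem bddAbove_rankAtLeast [Nonempty V] (G : Multigraph V E) (D : Divisor V) :
    BddAbove {k : ℕ | G.RankAtLeast D k} :=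
  ⟨D.deg.toNat, fun k hk => by have := RankAtLeast.le_deg hk; omega⟩

theorem le_rank_iff [Nonempty V] {G : Multigraph V E} {D : Divisor V} {r : ℕ} :
    (r : ℤ) ≤ G.rank D ↔ G.RankAtLeast D r := by
  constructor
  · intro h
    rw [rank] at h
    split_ifs at h with h0
    · omega
    · have h1 : r ≤ sSup {k : ℕ | G.RankAtLeast D k} := by exact_mod_cast h
      -- The supremum is attained only if the set is nonempty; `0` lies in it because the only
      -- effective divisor of degree zero is `0`.
      have h2 : (0 : ℕ) ∈ {k : ℕ | G.RankAtLeast D k} := by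
        intro F hF hk
        have : F = 0 := by
          funext v
          exact (Finset.sum_eq_zero_iff_of_nonneg fun w _ => hF w).1 hk v (Finset.mem_univ v)
        rw [this, sub_zero]
        exact Set.nonempty_iff_ne_empty.2 h0
      have h3 : G.RankAtLeast D (sSup {k : ℕ | G.RankAtLeast D k}) :=
        Nat.sSup_mem ⟨0, h2⟩ (bddAbove_rankAtLeast G D)
      exact h3.mono h1
  · intro h
    rw [rank, if_neg (Set.nonempty_iff_ne_empty.1 h.linearSystem_nonempty)]
    exact_mod_cast le_csSup (bddAbove_rankAtLeast G D) h

theorem rank_eq_iff [Nonempty V] {G : Multigraph V E} {D : Divisor V} {r : ℕ} :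
    G.rank D = (r : ℤ) ↔ G.RankAtLeast D r ∧ ¬ G.RankAtLeast D (r + 1) := by
  rw [← le_rank_iff, ← le_rank_iff]
  push_cast
  omega

theorem bddBelow_dgon [Nonempty V] (G : Multigraph V E) (r : ℕ) :
    BddBelow {d : ℤ | ∃ D : Divisor V, G.rank D = (r : ℤ) ∧ D.deg = d} := by
  refine ⟨(r : ℤ), ?_⟩
  rintro d ⟨D, h, rfl⟩
  exact (rank_eq_iff.1 h).1.le_deg

/-- `dgon` asks for rank exactly `r`. Removing a chip lowers the rank by at most one, so chips can
be removed until the rank is `r`; the rank never exceeds the degree, which ends the process. -/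
theorem RankAtLeast.exists_rank_eq [Nonempty V] {G : Multigraph V E} {r : ℕ} :
    ∀ {D : Divisor V}, G.RankAtLeast D r →
      ∃ D' : Divisor V, G.rank D' = (r : ℤ) ∧ D'.deg ≤ D.deg := by
  suffices H : ∀ (d : ℕ) (D : Divisor V), D.deg = (d : ℤ) → G.RankAtLeast D r →
      ∃ D' : Divisor V, G.rank D' = (r : ℤ) ∧ D'.deg ≤ D.deg by
    intro D h
    have := h.le_deg
    exact H D.deg.toNat D (by omega) h
  intro d
  induction d with
  | zero =>
    intro D hd h
    refine ⟨D, rank_eq_iff.2 ⟨h, fun h' => ?_⟩, le_rfl⟩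
    have := h'.le_deg
    push_cast at this hd
    omega
  | succ d ih =>
    intro D hd h
    by_cases h' : G.RankAtLeast D (r + 1)
    · have v := Classical.arbitrary V
      have h1 : Divisor.deg (D - Pi.single v 1) = (d : ℤ) := by
        rw [deg_sub, deg_single, hd]; push_cast; ring
      obtain ⟨D', h2, h3⟩ := ih _ h1 (h'.sub_single v)
      exact ⟨D', h2, by push_cast at hd; omega⟩
    · exact ⟨D, rank_eq_iff.2 ⟨h, h'⟩, le_rfl⟩

theorem RankAtLeast.dgon_le_deg [Nonempty V] {G : Multigraph V E} {D : Divisor V} {r : ℕ}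
    (h : G.RankAtLeast D r) : G.dgon r ≤ D.deg := by
  obtain ⟨D', h1, h2⟩ := h.exists_rank_eq
  exact (csInf_le (bddBelow_dgon G r) ⟨D', h1, rfl⟩).trans h2

theorem RankAtLeast.le_dgon [Nonempty V] {G : Multigraph V E} {D : Divisor V} {r : ℕ}
    (h : G.RankAtLeast D r) : (r : ℤ) ≤ G.dgon r := by
  obtain ⟨D', h1, h2⟩ := h.exists_rank_eq
  refine le_csInf ⟨_, D', h1, rfl⟩ ?_
  rintro d ⟨D, h, rfl⟩
  exact (rank_eq_iff.1 h).1.le_deg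

theorem RankAtLeast.exists_effective {G : Multigraph V E} {D : Divisor V} {r : ℕ}
    (h : G.RankAtLeast D r) {F : Divisor V} (hF : F.Effective) (hr : F.deg = (r : ℤ)) :
    ∃ σ : V → ℤ, ∀ v, F v ≤ D v - G.laplacian.mulVec σ v := by
  obtain ⟨D', ⟨σ, rfl⟩, h2⟩ := h F hF hr
  refine ⟨σ, fun v => ?_⟩
  have := h2 v
  simp only [Pi.sub_apply] at this
  omega

end Rank

/-! ### Independent sets in subcubic graphs. -/

section Independence

variable {V E : Type} [Fintype V] [DecidableEq V] [Fintype E]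

theorem isIndependent_iff {G : Multigraph V E} {S : Finset V} :
    G.IsIndependent S ↔ ∀ e, ¬ (G.ends e false ∈ S ∧ G.ends e true ∈ S) := by
  constructor
  · rintro h e ⟨h1, h2⟩
    have := h _ h1 _ h2
    exact Finset.filter_eq_empty_iff.1 this (Finset.mem_univ e) ⟨false, rfl, rfl⟩
  · intro h v hv w hw
    refine Finset.filter_eq_empty_iff.2 ?_
    rintro e - ⟨b, rfl, rfl⟩
    cases b
    · exact h e ⟨hv, hw⟩
    · exact h e ⟨hw, hv⟩

theorem exists_isIndependent_card_eq (G : Multigraph V E) :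
    ∃ S : Finset V, G.IsIndependent S ∧ S.card = G.indepNumber := by
  refine Nat.sSup_mem (s := {k : ℕ | ∃ S : Finset V, G.IsIndependent S ∧ S.card = k})
    ⟨0, ∅, by simp [IsIndependent], rfl⟩ ⟨Fintype.card V, ?_⟩
  rintro k ⟨S, -, rfl⟩
  exact Finset.card_le_univ S

theorem IsIndependent.card_le {G : Multigraph V E} {S : Finset V} (h : G.IsIndependent S) :
    S.card ≤ G.indepNumber := by
  refine le_csSup ⟨Fintype.card V, ?_⟩ ⟨S, h, rfl⟩
  rintro k ⟨S, -, rfl⟩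
  exact Finset.card_le_univ S

theorem sum_valence (G : Multigraph V E) : ∑ v, G.valence v = 2 * Fintype.card E := by
  simp only [valence_eq_sum]
  rw [Finset.sum_comm]
  have : ∀ e, ∑ v, ∑ b, (if G.ends e b = v then 1 else 0) = 2 := by
    intro e
    rw [Finset.sum_comm]
    simp
  rw [Finset.sum_congr rfl fun e _ => this e]
  simp [mul_comm]

theorem IsSubcubic.two_mul_card_le {G : Multigraph V E} (h : G.IsSubcubic) :
    2 * Fintype.card E ≤ 3 * Fintype.card V := by
  rw [← sum_valence G]
  calc _ ≤ ∑ _v : V, 3 := Finset.sum_le_sum fun v _ => h v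
    _ = _ := by simp [mul_comm]

/-- A maximum independent set is dominating, and each of its vertices has at most three neighbours.
-/
theorem IsSubcubic.card_le_four_mul {G : Multigraph V E} (h : G.IsSubcubic) :
    Fintype.card V ≤ 4 * G.indepNumber := by
  obtain ⟨S, hS, hcard⟩ := G.exists_isIndependent_card_eq
  have hnb : ∀ v, v ∉ S → ∃ e b, G.ends e b = v ∧ G.ends e (!b) ∈ S := by
    intro v hv
    by_contra! hno
    have : G.IsIndependent (insert v S) := by
      rw [isIndependent_iff] at hS ⊢
      rintro e ⟨h1, h2⟩
      have hl := G.loopless e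
      rw [Finset.mem_insert] at h1 h2
      rcases h1 with h1 | h1 <;> rcases h2 with h2 | h2
      · exact hl (h1.trans h2.symm)
      · exact hno e false h1 h2
      · exact hno e true h2 h1
      · exact hS e ⟨h1, h2⟩
    have := this.card_le
    rw [Finset.card_insert_of_notMem hv] at this
    omega
  have hsub : Sᶜ ⊆ S.biUnion fun s =>
      (Finset.univ.filter fun e => ∃ b, G.ends e b = s).biUnion fun e =>
        ({G.ends e false, G.ends e true} : Finset V).erase s := by
    intro v hv
    obtain ⟨e, b, rfl, h2⟩ := hnb v (Finset.mem_compl.1 hv)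
    simp only [Finset.mem_biUnion, Finset.mem_filter, Finset.mem_univ, true_and,
      Finset.mem_erase, Finset.mem_insert, Finset.mem_singleton]
    exact ⟨_, h2, e, ⟨!b, rfl⟩, G.ends_ne e b, by cases b <;> simp⟩
  have h1 : (Sᶜ).card ≤ S.card * 3 := by
    refine (Finset.card_le_card hsub).trans (Finset.card_biUnion_le_card_mul _ _ _ fun s _ => ?_)
    refine (Finset.card_biUnion_le_card_mul _ _ 1 fun e he => ?_).trans ((mul_one _).trans_le (h s))
    obtain ⟨b, hb⟩ := (Finset.mem_filter.1 he).2
    rw [Finset.card_erase_of_mem (by cases b <;> simp [hb])]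
    have := Finset.card_le_two (a := G.ends e false) (b := G.ends e true)
    omega
  rw [Finset.card_compl] at h1
  omega

end Independence

end Multigraph

/-! ### Sums over the vertices and edges of `G'_r`. -/

section AuxSums

variable {V E : Type} [Fintype V] [DecidableEq V] [Fintype E] [DecidableEq E]

/-- The vertices of `G'_r` as a disjoint union. -/
def AuxVertex.equivSum (V E : Type) : AuxVertex V E ≃ Unit ⊕ V ⊕ V ⊕ V ⊕ (E × Bool) where
  toFun
    | .top => .inl ()
    | .orig v => .inr (.inl v)
    | .prime v => .inr (.inr (.inl v))
    | .tip v => .inr (.inr (.inr (.inl v)))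
    | .edgeEnd e b => .inr (.inr (.inr (.inr (e, b))))
  invFun
    | .inl _ => .top
    | .inr (.inl v) => .orig v
    | .inr (.inr (.inl v)) => .prime v
    | .inr (.inr (.inr (.inl v))) => .tip v
    | .inr (.inr (.inr (.inr (e, b)))) => .edgeEnd e b
  left_inv x := by cases x <;> rfl
  right_inv x := by rcases x with _ | _ | _ | _ | _ <;> rfl

/-- The edges of `G'_r` as a disjoint union. -/
def AuxEdge.equivSum (V E : Type) (r M : ℕ) : AuxEdge V E r M ≃
    (V × Fin M) ⊕ (V × Fin M) ⊕ (V × Fin (r + 2)) ⊕ ((E × Bool) × Fin M) ⊕ (E × Fin r) where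
  toFun
    | .topTip v k => .inl (v, k)
    | .origPrime v k => .inr (.inl (v, k))
    | .primeTip v k => .inr (.inr (.inl (v, k)))
    | .origEnd e b k => .inr (.inr (.inr (.inl ((e, b), k))))
    | .link e k => .inr (.inr (.inr (.inr (e, k))))
  invFun
    | .inl (v, k) => .topTip v k
    | .inr (.inl (v, k)) => .origPrime v k
    | .inr (.inr (.inl (v, k))) => .primeTip v k
    | .inr (.inr (.inr (.inl ((e, b), k)))) => .origEnd e b k
    | .inr (.inr (.inr (.inr (e, k)))) => .link e k
  left_inv x := by cases x <;> rfl
  right_inv x := by rcases x with _ | _ | _ | _ | _ <;> rfl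

theorem AuxVertex.sum_eq (f : AuxVertex V E → ℤ) :
    ∑ x, f x = f .top + ∑ v, f (.orig v) + ∑ v, f (.prime v) + ∑ v, f (.tip v) +
      ∑ e, f (.edgeEnd e false) + ∑ e, f (.edgeEnd e true) := by
  rw [← (AuxVertex.equivSum V E).symm.sum_comp]
  simp only [Fintype.sum_sum_type, Fintype.sum_prod_type, Fintype.sum_bool,
    Finset.sum_add_distrib, AuxVertex.equivSum, Equiv.coe_fn_symm_mk, Finset.univ_unique,
    Finset.sum_singleton]
  ring

theorem AuxEdge.sum_eq {r M : ℕ} (f : AuxEdge V E r M → ℤ) :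
    ∑ x, f x = ∑ v, ∑ k, f (.topTip v k) + ∑ v, ∑ k, f (.origPrime v k) +
      ∑ v, ∑ k, f (.primeTip v k) + ∑ e, ∑ b, ∑ k, f (.origEnd e b k) +
      ∑ e, ∑ k, f (.link e k) := by
  rw [← (AuxEdge.equivSum V E r M).symm.sum_comp]
  simp only [Fintype.sum_sum_type, Fintype.sum_prod_type, AuxEdge.equivSum,
    Equiv.coe_fn_symm_mk]
  ring

end AuxSums

theorem Divisor.deg_eq_sum_pairs {V E : Type} [Fintype V] [DecidableEq V] [Fintype E]
    [DecidableEq E] (D : Divisor (AuxVertex V E)) :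
    D.deg = D .top + ∑ v, D (.orig v) + ∑ v, (D (.prime v) + D (.tip v)) +
      ∑ e, (D (.edgeEnd e false) + D (.edgeEnd e true)) := by
  rw [Divisor.deg, AuxVertex.sum_eq, Finset.sum_add_distrib, Finset.sum_add_distrib]
  ring

/-! ### Firing on `G'_r` with scripts that are constant along the bundles. -/

namespace Multigraph

variable {V E : Type} [Fintype V] [DecidableEq V] [Fintype E] [DecidableEq E]

/-- The function `σ` is constant along the large bundles of `G'_r`. -/
structure BundleConstant (G : Multigraph V E) (σ : AuxVertex V E → ℤ) : Prop where
  tip : ∀ v, σ (.tip v) = σ .top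
  prime : ∀ v, σ (.prime v) = σ (.orig v)
  edgeEnd : ∀ e b, σ (.edgeEnd e b) = σ (.orig (G.ends e b))

namespace BundleConstant

variable {G : Multigraph V E} {σ : AuxVertex V E → ℤ}

theorem laplacian_top (h : G.BundleConstant σ) (r : ℕ) :
    (G.aux r).laplacian.mulVec σ .top = 0 := by
  rw [laplacian_mulVec_apply, AuxEdge.sum_eq]
  simp [aux, h.tip]

theorem laplacian_orig (h : G.BundleConstant σ) (r : ℕ) (v : V) :
    (G.aux r).laplacian.mulVec σ (.orig v) = 0 := by
  rw [laplacian_mulVec_apply, AuxEdge.sum_eq]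
  simp [aux, h.prime, h.edgeEnd]
  refine Finset.sum_eq_zero fun e _ => ?_
  split_ifs <;> simp_all

theorem laplacian_prime (h : G.BundleConstant σ) (r : ℕ) (v : V) :
    (G.aux r).laplacian.mulVec σ (.prime v) = (r + 2) * (σ (.orig v) - σ .top) := by
  rw [laplacian_mulVec_apply, AuxEdge.sum_eq]
  simp [aux, h.prime, h.tip, mul_sub]

theorem laplacian_tip (h : G.BundleConstant σ) (r : ℕ) (v : V) :
    (G.aux r).laplacian.mulVec σ (.tip v) = (r + 2) * (σ .top - σ (.orig v)) := by
  rw [laplacian_mulVec_apply, AuxEdge.sum_eq]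
  simp [aux, h.prime, h.tip, mul_sub]

theorem laplacian_edgeEnd (h : G.BundleConstant σ) (r : ℕ) (e : E) (b : Bool) :
    (G.aux r).laplacian.mulVec σ (.edgeEnd e b) =
      r * (σ (.orig (G.ends e b)) - σ (.orig (G.ends e (!b)))) := by
  rw [laplacian_mulVec_apply, AuxEdge.sum_eq]
  cases b <;> simp [aux, h.edgeEnd, ite_and, mul_sub]

end BundleConstant

theorem le_card_edgesBetween {V E : Type} [Fintype V] [DecidableEq V] [Fintype E]
    (G : Multigraph V E) {k : ℕ} (f : Fin k → E) (hf : f.Injective) {a b : V}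
    (h : ∀ i, ∃ c, G.ends (f i) c = a ∧ G.ends (f i) (!c) = b) :
    k ≤ (G.edgesBetween a b).card := by
  have : (Finset.univ.map ⟨f, hf⟩).card = k := by simp
  rw [← this]
  refine Finset.card_le_card fun e he => ?_
  obtain ⟨i, -, rfl⟩ := Finset.mem_map.1 he
  exact Finset.mem_filter.2 ⟨Finset.mem_univ _, h i⟩

/-- Each bundle has more edges than there are chips, so `le_of_deg_lt_card` applies in both
directions. -/
theorem bundleConstant_of_deg_lt {G : Multigraph V E} {r : ℕ} {D : Divisor (AuxVertex V E)}
    {σ : AuxVertex V E → ℤ} (hD : D.Effective)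
    (hD' : (D - (G.aux r).laplacian.mulVec σ : Divisor _).Effective)
    (hdeg : D.deg < bundleSize V E r) : G.BundleConstant σ := by
  have key : ∀ {a b : AuxVertex V E} (f : Fin (bundleSize V E r) → AuxEdge V E r _),
      f.Injective → (∀ i, (G.aux r).ends (f i) true = a ∧ (G.aux r).ends (f i) false = b) →
      σ a = σ b := by
    intro a b f hf h
    apply le_antisymm
    · exact le_of_deg_lt_card hD hD' (hdeg.trans_le (by
        exact_mod_cast (G.aux r).le_card_edgesBetween f hf fun i => ⟨true, h i⟩))
    · exact le_of_deg_lt_card hD hD' (hdeg.trans_le (by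
        exact_mod_cast (G.aux r).le_card_edgesBetween f hf fun i => ⟨false, (h i).symm⟩))
  exact
    { tip := fun v => key (fun k => .topTip v k) (fun i j h => by simpa using h)
        fun i => ⟨rfl, rfl⟩
      prime := fun v => key (fun k => .origPrime v k) (fun i j h => by simpa using h)
        fun i => ⟨rfl, rfl⟩
      edgeEnd := fun e b => key (fun k => .origEnd e b k) (fun i j h => by simpa using h)
        fun i => ⟨rfl, rfl⟩ }

/-! ### An upper bound for the gonality -/

section Upper

/-- The divisor on `G'_r` obtained from a vertex set `S` and a height function on the vertices;
only the vertices outside `S` can be separated from `T`, in the order of their heights. -/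
def heightDivisor (G : Multigraph V E) (r : ℕ) (S : Finset V) (ht : V → ℕ) :
    Divisor (AuxVertex V E)
  | .top => r
  | .orig _ => r
  | .prime v => if v ∈ S then r else r - 1
  | .tip v => if v ∈ S then r else r + 2
  | .edgeEnd e b => if ht (G.ends e b) < ht (G.ends e (!b)) then r - 1 else r

theorem deg_heightDivisor {G : Multigraph V E} (r : ℕ) (S : Finset V) {ht : V → ℕ}
    (hne : ∀ e, ht (G.ends e false) ≠ ht (G.ends e true)) :
    (G.heightDivisor r S ht).deg =
      (3 * r + 1) * Fintype.card V + (2 * r - 1) * Fintype.card E + r - S.card := by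
  rw [Divisor.deg_eq_sum_pairs]
  have h1 : ∀ v, G.heightDivisor r S ht (.prime v) + G.heightDivisor r S ht (.tip v) =
      (2 * r + 1) - if v ∈ S then 1 else 0 := by
    intro v
    simp only [heightDivisor]
    split_ifs <;> ring
  have h2 : ∀ e, G.heightDivisor r S ht (.edgeEnd e false) +
      G.heightDivisor r S ht (.edgeEnd e true) = 2 * r - 1 := by
    intro e
    have := hne e
    simp only [heightDivisor, Bool.not_true, Bool.not_false]
    split_ifs <;> omega
  simp only [h1, h2]
  simp [heightDivisor, Finset.sum_sub_distrib]
  ring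

/-- The indicator function of the vertices of `G'_r` that belong to a vertex of height
at most `k`. -/
def lowScript (G : Multigraph V E) (ht : V → ℕ) (k : ℕ) : AuxVertex V E → ℤ
  | .top => 0
  | .tip _ => 0
  | .orig v => if ht v ≤ k then 1 else 0
  | .prime v => if ht v ≤ k then 1 else 0
  | .edgeEnd e b => if ht (G.ends e b) ≤ k then 1 else 0

theorem bundleConstant_lowScript (G : Multigraph V E) (ht : V → ℕ) (k : ℕ) :
    G.BundleConstant (-G.lowScript ht k) where
  tip _ := rfl
  prime _ := rfl
  edgeEnd _ _ := rfl

/-- Every vertex has at least `r-1` chips, so the only harmful demands are `r` chips at one vertex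
that has `r-1`. Such a vertex belongs to some `v` outside `S`. Letting all vertices of height at
most `ht v` borrow repairs it: these lie outside `S`, so their tips can pay `r+2`, and the upper
ends of the edges crossed can pay `r`. -/
theorem rankAtLeast_heightDivisor {G : Multigraph V E} {r : ℕ} (hr : 1 ≤ r) {S : Finset V}
    {ht : V → ℕ} (hS : ∀ s ∈ S, ∀ v, v ∉ S → ht v < ht s)
    (hind : ∀ e, ¬ (G.ends e false ∈ S ∧ G.ends e true ∈ S)) :
    (G.aux r).RankAtLeast (G.heightDivisor r S ht) r := by
  intro F hF hFr
  by_cases hall : ∀ x, F x ≤ G.heightDivisor r S ht x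
  · exact ⟨_, equivalent_refl _ _, fun x => sub_nonneg.2 (hall x)⟩
  push Not at hall
  obtain ⟨y, hy⟩ := hall
  have hge : ∀ x, (r : ℤ) - 1 ≤ G.heightDivisor r S ht x := by
    intro x
    cases x <;> simp only [heightDivisor] <;> (try split_ifs) <;> omega
  have hyr : F y + ∑ x ∈ Finset.univ.erase y, F x = r := by
    rw [← hFr, Divisor.deg, Finset.add_sum_erase _ _ (Finset.mem_univ y)]
  have hrest : 0 ≤ ∑ x ∈ Finset.univ.erase y, F x := Finset.sum_nonneg fun x _ => hF x
  have hy0 := hge y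
  -- `F y` exceeds a number that is at least `r-1`, so it uses up the whole degree of `F`.
  have hFy : F y = r := by omega
  have hF0 : ∀ x, x ≠ y → F x = 0 := fun x hx =>
    (Finset.sum_eq_zero_iff_of_nonneg fun w _ => hF w).1 (by omega) x
      (Finset.mem_erase.2 ⟨hx, Finset.mem_univ x⟩)
  suffices H : ∃ k, (∀ s ∈ S, k < ht s) ∧
      0 ≤ (G.heightDivisor r S ht - (G.aux r).laplacian.mulVec (-G.lowScript ht k)) y - r by
    obtain ⟨k, hk, hyk⟩ := H
    have hb := bundleConstant_lowScript G ht k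
    refine ⟨G.heightDivisor r S ht - F - (G.aux r).laplacian.mulVec (-G.lowScript ht k),
      ⟨_, rfl⟩, fun x => ?_⟩
    by_cases hxy : x = y
    · subst hxy
      simp only [Pi.sub_apply] at hyk ⊢
      omega
    · simp only [Pi.sub_apply, hF0 x hxy]
      cases x with
      | top => rw [hb.laplacian_top]; simp [heightDivisor]
      | orig v => rw [hb.laplacian_orig]; simp [heightDivisor]
      | prime v =>
        rw [hb.laplacian_prime]
        simp only [heightDivisor, Pi.neg_apply, lowScript]
        have := hk v
        have hvS : ht v ≤ k → v ∉ S := fun h1 h2 => (hk v h2).not_ge h1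
        split_ifs <;> first | (exfalso; tauto) | simp <;> omega
      | tip v =>
        rw [hb.laplacian_tip]
        simp only [heightDivisor, Pi.neg_apply, lowScript]
        have := hk v
        have hvS : ht v ≤ k → v ∉ S := fun h1 h2 => (hk v h2).not_ge h1
        split_ifs <;> first | (exfalso; tauto) | simp <;> omega
      | edgeEnd e b =>
        rw [hb.laplacian_edgeEnd]
        simp only [heightDivisor, Pi.neg_apply, lowScript]
        split_ifs <;> simp <;> omega
  cases y with
  | top => simp only [heightDivisor] at hy; omega
  | orig v => simp only [heightDivisor] at hy; omega
  | prime v =>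
    have hv : v ∉ S := fun hv => by simp only [heightDivisor, if_pos hv] at hy; omega
    refine ⟨ht v, fun s hs => hS s hs v hv, ?_⟩
    rw [Pi.sub_apply, (bundleConstant_lowScript G ht _).laplacian_prime]
    simp [heightDivisor, lowScript, hv]
    omega
  | tip v => simp only [heightDivisor] at hy; split_ifs at hy <;> omega
  | edgeEnd e b =>
    have hlt : ht (G.ends e b) < ht (G.ends e (!b)) := by
      by_contra hlt
      simp only [heightDivisor, if_neg hlt] at hy
      omega
    -- The lower end of an edge is outside `S`: heights are largest on `S`, and `S` contains no
    -- edge.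
    have hv : G.ends e b ∉ S := by
      intro hv
      by_cases hw : G.ends e (!b) ∈ S
      · cases b
        · exact hind e ⟨hv, hw⟩
        · exact hind e ⟨hw, hv⟩
      · exact (hS _ hv _ hw).not_gt hlt
    refine ⟨ht (G.ends e b), fun s hs => hS s hs _ hv, ?_⟩
    rw [Pi.sub_apply, (bundleConstant_lowScript G ht _).laplacian_edgeEnd]
    simp [heightDivisor, lowScript, hlt, hlt.not_ge]
    omega

instance : Nonempty (AuxVertex V E) := ⟨.top⟩

theorem dgon_aux_le (G : Multigraph V E) {r : ℕ} (hr : 1 ≤ r) :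
    (G.aux r).dgon r ≤
      (3 * r + 1) * Fintype.card V + (2 * r - 1) * Fintype.card E + r - G.indepNumber := by
  obtain ⟨S, hS, hcard⟩ := G.exists_isIndependent_card_eq
  -- Outside `S` the heights come from an enumeration and are distinct and below `|V|`. On `S` they
  -- coincide, which is harmless since no edge joins two vertices of `S`.
  set ht : V → ℕ := fun v =>
    if v ∈ S then Fintype.card V else (Fintype.equivFin V v : ℕ) with hht
  rw [isIndependent_iff] at hS
  have hne : ∀ e, ht (G.ends e false) ≠ ht (G.ends e true) := by
    intro e h
    have h0 := hS e
    have h1 := ((Fintype.equivFin V) (G.ends e false)).isLt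
    have h2 := ((Fintype.equivFin V) (G.ends e true)).isLt
    simp only [hht] at h
    split_ifs at h with h3 h4 h4
    · exact h0 ⟨h3, h4⟩
    · omega
    · omega
    · exact G.loopless e ((Fintype.equivFin V).injective (Fin.ext h))
  have hlt : ∀ s ∈ S, ∀ v, v ∉ S → ht v < ht s := by
    intro s hs v hv
    simp only [hht, if_pos hs, if_neg hv]
    exact Fin.isLt _
  have := (rankAtLeast_heightDivisor hr hlt hS).dgon_le_deg
  rwa [deg_heightDivisor r S hne, hcard] at this

end Upper

/-! ### Divisors of small degree and large rank -/

section Lower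

/-- If the pair `(a, N - a)` can be changed in steps of `(s, -s)` so as to dominate every pair of
non-negative numbers with sum `r`, then `s ≤ N - r + 1`, or `N` is at least `2r` and a single pair
works. -/
theorem exists_step {a N r s : ℤ} (hr : 0 ≤ r) (hs : 0 ≤ s)
    (h : ∀ x, 0 ≤ x → x ≤ r → ∃ k, x ≤ a + s * k ∧ r - x ≤ N - (a + s * k)) :
    (∃ k l, k < l ∧ 0 ≤ a + s * k ∧ a + s * l ≤ N ∧ s ≤ N - r + 1) ∨
      ∃ k, r ≤ a + s * k ∧ r ≤ N - (a + s * k) := by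
  -- With all `r` chips demanded on the second side, the first side may hold fewer than `r`.
  obtain ⟨k, hk1, hk2⟩ := h 0 le_rfl hr
  by_cases hkr : r ≤ a + s * k
  · exact .inr ⟨k, hkr, by omega⟩
  -- Demanding one chip more than the first side holds forces a whole further step of size `s`,
  -- while the second side must still keep `r - (a + s * k) - 1` chips.
  · obtain ⟨l, hl1, hl2⟩ := h (a + s * k + 1) (by omega) (by omega)
    have hkl : k < l := by
      by_contra! hlk
      have := mul_le_mul_of_nonneg_left hlk hs
      omega
    have : s * (k + 1) ≤ s * l := mul_le_mul_of_nonneg_left (by omega) hs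
    rw [mul_add, mul_one] at this
    exact .inl ⟨k, l, hkl, hk1, by omega, by omega⟩

variable {G : Multigraph V E} {r : ℕ} {D : Divisor (AuxVertex V E)}

theorem exists_bundleConstant (hD : D.Effective) (hrank : (G.aux r).RankAtLeast D r)
    (hdeg : D.deg < bundleSize V E r) {F : Divisor (AuxVertex V E)} (hF : F.Effective)
    (hFr : F.deg = r) : ∃ σ, G.BundleConstant σ ∧
      (∀ x, F x ≤ D x - (G.aux r).laplacian.mulVec σ x) ∧
      ∀ x, 0 ≤ D x - (G.aux r).laplacian.mulVec σ x := by
  obtain ⟨σ, hσ⟩ := hrank.exists_effective hF hFr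
  have h0 : ∀ x, 0 ≤ D x - (G.aux r).laplacian.mulVec σ x := fun x => (hF x).trans (hσ x)
  exact ⟨σ, bundleConstant_of_deg_lt hD h0 hdeg, hσ, h0⟩

theorem le_apply_top (hD : D.Effective) (hrank : (G.aux r).RankAtLeast D r)
    (hdeg : D.deg < bundleSize V E r) : (r : ℤ) ≤ D .top := by
  obtain ⟨σ, hσ, h, -⟩ := exists_bundleConstant hD hrank hdeg
    (effective_single .top (Int.natCast_nonneg r)) (deg_single _ _)
  simpa [hσ.laplacian_top] using h .top

theorem le_apply_orig (hD : D.Effective) (hrank : (G.aux r).RankAtLeast D r)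
    (hdeg : D.deg < bundleSize V E r) (v : V) : (r : ℤ) ≤ D (.orig v) := by
  obtain ⟨σ, hσ, h, -⟩ := exists_bundleConstant hD hrank hdeg
    (effective_single (.orig v) (Int.natCast_nonneg r)) (deg_single _ _)
  simpa [hσ.laplacian_orig] using h (.orig v)

theorem exists_bundleConstant_pair (hD : D.Effective) (hrank : (G.aux r).RankAtLeast D r)
    (hdeg : D.deg < bundleSize V E r) {y z : AuxVertex V E} (hyz : y ≠ z) {x : ℤ} (hx : 0 ≤ x)
    (hxr : x ≤ r) : ∃ σ, G.BundleConstant σ ∧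
      x ≤ D y - (G.aux r).laplacian.mulVec σ y ∧
      r - x ≤ D z - (G.aux r).laplacian.mulVec σ z ∧
      ∀ w, 0 ≤ D w - (G.aux r).laplacian.mulVec σ w := by
  obtain ⟨σ, hσ, h, h0⟩ := exists_bundleConstant hD hrank hdeg
    (F := Pi.single y x + Pi.single z (r - x))
    (fun w => add_nonneg (effective_single y hx w) (effective_single z (by omega) w)) (by
      have h1 := deg_single y x
      have h2 := deg_single z (r - x)
      simp only [Divisor.deg, Pi.add_apply, Finset.sum_add_distrib] at h1 h2 ⊢
      omega)
  have h1 := h y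
  have h2 := h z
  simp only [Pi.add_apply, Pi.single_eq_same, Pi.single_eq_of_ne hyz,
    Pi.single_eq_of_ne hyz.symm, add_zero, zero_add] at h1 h2
  exact ⟨σ, hσ, h1, h2, h0⟩

/-- With step `r+2`, the first case of `exists_step` costs at least `2r+1` chips. So a total of at
most `2r` means the second case: some shift of the pair is `(r, r)`, and a nonzero shift of `(r, r)`
by `r+2` would create debt. -/
theorem two_mul_le_prime_add_tip (hD : D.Effective) (hrank : (G.aux r).RankAtLeast D r)
    (hdeg : D.deg < bundleSize V E r) (v : V) :
    2 * (r : ℤ) ≤ D (.prime v) + D (.tip v) ∧ (D (.prime v) + D (.tip v) ≤ 2 * r →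
      D (.prime v) = r ∧ D (.tip v) = r) := by
  have hstep := exists_step (a := D (.prime v)) (N := D (.prime v) + D (.tip v)) (r := r)
    (s := r + 2) (by positivity) (by positivity) (by
      intro x hx hxr
      obtain ⟨σ, hσ, h1, h2, -⟩ := exists_bundleConstant_pair hD hrank hdeg
        (y := .prime v) (z := .tip v) (by simp) hx hxr
      rw [hσ.laplacian_prime] at h1
      rw [hσ.laplacian_tip] at h2
      exact ⟨σ .top - σ (.orig v), by linarith, by linarith⟩)
  have hp := hD (.prime v)
  have ht := hD (.tip v)
  rcases hstep with ⟨k, l, hkl, h1, h2, h3⟩ | ⟨k, h1, h2⟩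
  · omega
  · refine ⟨by omega, fun hN => ?_⟩
    have hk : k = 0 := by
      by_contra hk
      rcases lt_or_gt_of_ne hk with hk | hk
      · have : ((r : ℤ) + 2) * k ≤ (r + 2) * (-1) :=
          mul_le_mul_of_nonneg_left (by omega) (by positivity)
        omega
      · have : ((r : ℤ) + 2) * 1 ≤ (r + 2) * k :=
          mul_le_mul_of_nonneg_left (by omega) (by positivity)
        omega
    subst hk
    omega

/-- With step `r`, the first case of `exists_step` gives `2r-1` and the second `2r`. -/
theorem le_edgeEnd_add_edgeEnd (hD : D.Effective) (hrank : (G.aux r).RankAtLeast D r)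
    (hdeg : D.deg < bundleSize V E r) (e : E) :
    2 * (r : ℤ) - 1 ≤ D (.edgeEnd e false) + D (.edgeEnd e true) := by
  have hstep := exists_step (a := D (.edgeEnd e false))
    (N := D (.edgeEnd e false) + D (.edgeEnd e true)) (r := r) (s := r) (by positivity)
    (by positivity) (by
      intro x hx hxr
      obtain ⟨σ, hσ, h1, h2, -⟩ := exists_bundleConstant_pair hD hrank hdeg
        (y := .edgeEnd e false) (z := .edgeEnd e true) (by simp) hx hxr
      rw [hσ.laplacian_edgeEnd] at h1 h2
      simp only [Bool.not_true, Bool.not_false] at h1 h2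
      exact ⟨σ (.orig (G.ends e true)) - σ (.orig (G.ends e false)), by linarith, by linarith⟩)
  rcases hstep with ⟨k, l, hkl, h1, h2, h3⟩ | ⟨k, h1, h2⟩ <;> omega

/-- Both endpoints have frozen pairs `(r, r)`, so every admissible script takes the value of `T` at
both. No chips cross `e`, and each of its two vertices must hold `r` chips from the start. -/
theorem two_mul_le_edgeEnd_add_edgeEnd (hD : D.Effective)
    (hrank : (G.aux r).RankAtLeast D r) (hdeg : D.deg < bundleSize V E r) (e : E)
    (hends : ∀ b, D (.prime (G.ends e b)) + D (.tip (G.ends e b)) ≤ 2 * r) :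
    2 * (r : ℤ) ≤ D (.edgeEnd e false) + D (.edgeEnd e true) := by
  have hconst : ∀ σ, G.BundleConstant σ →
      (∀ w, 0 ≤ D w - (G.aux r).laplacian.mulVec σ w) → ∀ b, σ (.orig (G.ends e b)) = σ .top := by
    intro σ hσ h0 b
    obtain ⟨h1, h2⟩ := (two_mul_le_prime_add_tip hD hrank hdeg (G.ends e b)).2 (hends b)
    have h3 := h0 (.prime (G.ends e b))
    have h4 := h0 (.tip (G.ends e b))
    rw [hσ.laplacian_prime, h1] at h3
    rw [hσ.laplacian_tip, h2] at h4
    by_contra hk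
    rcases lt_or_gt_of_ne hk with hk | hk
    · have : ((r : ℤ) + 2) * 1 ≤ (r + 2) * (σ .top - σ (.orig (G.ends e b))) :=
        mul_le_mul_of_nonneg_left (by omega) (by positivity)
      omega
    · have : ((r : ℤ) + 2) * 1 ≤ (r + 2) * (σ (.orig (G.ends e b)) - σ .top) :=
        mul_le_mul_of_nonneg_left (by omega) (by positivity)
      omega
  have key : ∀ b, (r : ℤ) ≤ D (.edgeEnd e b) := by
    intro b
    obtain ⟨σ, hσ, h, h0⟩ := exists_bundleConstant hD hrank hdeg
      (effective_single (.edgeEnd e b) (Int.natCast_nonneg r)) (deg_single _ _)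
    have := h (.edgeEnd e b)
    rw [hσ.laplacian_edgeEnd, hconst σ hσ h0, hconst σ hσ h0] at this
    simpa using this
  have := key false
  have := key true
  omega

/-- The vertices from which the independent set is obtained by pruning. -/
def candidates (r : ℕ) (D : Divisor (AuxVertex V E)) : Finset V :=
  Finset.univ.filter fun v =>
    (bundleSize V E r : ℤ) ≤ D.deg ∨ D (.prime v) + D (.tip v) ≤ 2 * r

/-- Adding up the local bounds: a non-candidate costs one extra chip over `2r`, and an edge between
candidates one extra chip over `2r-1`. -/
theorem le_card_candidates (hD : D.Effective) (hrank : (G.aux r).RankAtLeast D r) :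
    ((3 * r + 1) * Fintype.card V + (2 * r - 1) * Fintype.card E + r - D.deg : ℤ) ≤
      (candidates r D).card - (Finset.univ.filter fun e =>
        G.ends e false ∈ candidates r D ∧ G.ends e true ∈ candidates r D).card := by
  -- For degree at least `M`, the left side is less than `|V| - |E|`, which is the right side when
  -- all vertices are candidates.
  by_cases hdeg : (bundleSize V E r : ℤ) ≤ D.deg
  · have h1 : candidates r D = Finset.univ := by simp [candidates, hdeg]
    rw [h1]
    simp only [Finset.mem_univ, and_self, Finset.filter_true, Finset.card_univ]
    rw [bundleSize] at hdeg
    push_cast at hdeg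
    linarith
  · have hlt := not_le.1 hdeg
    set A := candidates r D with hA
    set B : Finset E := Finset.univ.filter fun e => G.ends e false ∈ A ∧ G.ends e true ∈ A
      with hB
    have hmem : ∀ v, v ∈ A ↔ D (.prime v) + D (.tip v) ≤ 2 * r := by
      intro v
      simp [hA, candidates, hdeg]
    have h1 : ∑ v : V, (2 * (r : ℤ) + 1 - if v ∈ A then 1 else 0) ≤
        ∑ v, (D (.prime v) + D (.tip v)) := by
      refine Finset.sum_le_sum fun v _ => ?_
      have := (two_mul_le_prime_add_tip hD hrank hlt v).1
      split_ifs with h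
      · omega
      · rw [hmem] at h; omega
    have h2 : ∑ e : E, (2 * (r : ℤ) - 1 + if e ∈ B then 1 else 0) ≤
        ∑ e, (D (.edgeEnd e false) + D (.edgeEnd e true)) := by
      refine Finset.sum_le_sum fun e _ => ?_
      split_ifs with h
      · have h' := (Finset.mem_filter.1 h).2
        have := two_mul_le_edgeEnd_add_edgeEnd hD hrank hlt e (fun b => by
          cases b
          · exact (hmem _).1 h'.1
          · exact (hmem _).1 h'.2)
        omega
      · have := le_edgeEnd_add_edgeEnd hD hrank hlt e
        omega
    have h3 : ∑ _v : V, (r : ℤ) ≤ ∑ v, D (.orig v) :=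
      Finset.sum_le_sum fun v _ => le_apply_orig hD hrank hlt v
    have h4 := le_apply_top hD hrank hlt
    have h5 := D.deg_eq_sum_pairs
    simp only [Finset.sum_sub_distrib, Finset.sum_add_distrib, Finset.sum_const,
      Finset.card_univ, nsmul_eq_mul, Finset.sum_ite_mem, Finset.univ_inter, mul_one] at h1 h2 h3
    simp only [Finset.sum_add_distrib] at h5
    nlinarith

end Lower

end Multigraph

/-! ### Cost bounds for programs. -/

namespace RAM

/-- Started in `s`, the program `p` halts at total cost at most `B` in a state satisfying `Q`. -/
def Runs (p : Prog) (s : State) (B : ℕ) (Q : State → Prop) : Prop :=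
  ∃ s' t, Exec p s s' t ∧ t ≤ B ∧ Q s'

theorem Runs.mono {p : Prog} {s : State} {B B' : ℕ} {Q Q' : State → Prop} (h : Runs p s B Q)
    (hB : B ≤ B') (hQ : ∀ s', Q s' → Q' s') : Runs p s B' Q' := by
  obtain ⟨s', t, h1, h2, h3⟩ := h
  exact ⟨s', t, h1, h2.trans hB, hQ s' h3⟩

theorem Runs.seq {p q : Prog} {s : State} {B B' : ℕ} {Q R : State → Prop} (hp : Runs p s B Q)
    (hq : ∀ s', Q s' → Runs q s' B' R) : Runs (.seq p q) s (B + B') R := by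
  obtain ⟨s', t, h1, h2, h3⟩ := hp
  obtain ⟨s'', t', h4, h5, h6⟩ := hq s' h3
  exact ⟨s'', t + t', .seq h1 h4, add_le_add h2 h5, h6⟩

theorem Runs.ite {e : Expr} {p q : Prog} {s : State} {C B : ℕ} {Q : State → Prop}
    (hC : e.cost s + 1 ≤ C) (hp : e.eval s ≠ 0 → Runs p s B Q) (hq : e.eval s = 0 → Runs q s B Q) :
    Runs (.ite e p q) s (C + B) Q := by
  by_cases h : e.eval s = 0
  · obtain ⟨s', t, h1, h2, h3⟩ := hq h
    exact ⟨s', _, .ite_false h h1, add_le_add hC h2, h3⟩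
  · obtain ⟨s', t, h1, h2, h3⟩ := hp h
    exact ⟨s', _, .ite_true h h1, add_le_add hC h2, h3⟩

/-- A loop whose condition holds for exactly `N` iterations. -/
theorem Runs.while {e : Expr} {p : Prog} {C B N : ℕ} (I : ℕ → State → Prop)
    (hcost : ∀ k s, I k s → e.cost s + 1 ≤ C) (hhalt : ∀ s, I N s → e.eval s = 0)
    (hgo : ∀ k s, k < N → I k s → e.eval s ≠ 0 ∧ Runs p s B (I (k + 1))) {s : State}
    (hs : I 0 s) : Runs (.while e p) s (N * (C + B) + C) (I N) := by
  suffices H : ∀ j k s, k + j = N → I k s → Runs (.while e p) s (j * (C + B) + C) (I N) from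
    H N 0 s (by omega) hs
  intro j
  induction j with
  | zero =>
    intro k s hk hI
    obtain rfl : k = N := by omega
    exact ⟨s, _, .while_false (hhalt s hI), by simpa using hcost _ s hI, hI⟩
  | succ j ih =>
    intro k s hk hI
    obtain ⟨h0, s', t, h1, h2, h3⟩ := hgo k s (by omega) hI
    obtain ⟨s'', t', h4, h5, h6⟩ := ih (k + 1) s' (by omega) h3
    refine ⟨s'', _, .while_true h0 h1 h4, ?_, h6⟩
    have := hcost k s hI
    rw [add_mul, one_mul]
    omega

/-- All numbers in the state have at most `W` bits. -/
def Bdd (W : ℕ) (s : State) : Prop :=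
  (∀ x, s.var x < 2 ^ W) ∧ ∀ a i, s.arr a i < 2 ^ W

theorem Bdd.setVar {W : ℕ} {s : State} (h : Bdd W s) (x : ℕ) {k : ℕ} (hk : k < 2 ^ W) :
    Bdd W (s.setVar x k) := by
  refine ⟨fun y => ?_, h.2⟩
  simp only [State.setVar, Function.update_apply]
  split_ifs
  · exact hk
  · exact h.1 y

theorem Bdd.setArr {W : ℕ} {s : State} (h : Bdd W s) (a i : ℕ) {k : ℕ} (hk : k < 2 ^ W) :
    Bdd W (s.setArr a i k) := by
  refine ⟨h.1, fun b j => ?_⟩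
  simp only [State.setArr, Function.update_apply]
  split_ifs with h1
  · subst h1
    simp only [Function.update_apply]
    split_ifs
    · exact hk
    · exact h.2 b j
  · exact h.2 b j

/-- The value of `e` has at most `e.width * W` bits in a state with at most `W` bits. -/
def Expr.width : Expr → ℕ
  | .lit k => k.size
  | .var _ => 1
  | .read _ _ => 1
  | .add e f => e.width + f.width + 1
  | .sub e _ => e.width
  | .mul e f => e.width + f.width
  | .lt _ _ => 1

/-- The cost of `e` is at most `e.weight * W` in a state with at most `W` bits. -/
def Expr.weight : Expr → ℕ
  | .lit k => 1 + k.size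
  | .var _ => 2
  | .read _ i => i.weight + 2
  | .add e f => e.weight + f.weight + (1 + (e.width + f.width + 1))
  | .sub e f => e.weight + f.weight + (1 + e.width)
  | .mul e f => e.weight + f.weight + (1 + (e.width + f.width))
  | .lt e f => e.weight + f.weight + 2

theorem Expr.eval_lt {W : ℕ} (hW : 1 ≤ W) {s : State} (h : Bdd W s) (e : Expr) :
    e.eval s < 2 ^ (e.width * W) := by
  induction e with
  | lit k =>
    exact (Nat.lt_size_self k).trans_le
      (Nat.pow_le_pow_right two_pos (Nat.le_mul_of_pos_right _ hW))
  | var x => simpa [Expr.width, Expr.eval] using h.1 x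
  | read a i _ => simpa [Expr.width, Expr.eval] using h.2 a _
  | add e f he hf =>
    simp only [Expr.eval, Expr.width]
    have h1 : 2 ^ (e.width * W) ≤ 2 ^ ((e.width + f.width) * W) :=
      Nat.pow_le_pow_right two_pos (Nat.mul_le_mul_right _ (by omega))
    have h2 : 2 ^ (f.width * W) ≤ 2 ^ ((e.width + f.width) * W) :=
      Nat.pow_le_pow_right two_pos (Nat.mul_le_mul_right _ (by omega))
    -- The carry bit of the addition is absorbed by one more block of `W ≥ 1` bits.
    have h3 : 2 ^ ((e.width + f.width) * W + 1) ≤ 2 ^ ((e.width + f.width + 1) * W) :=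
      Nat.pow_le_pow_right two_pos (by rw [add_mul _ 1]; omega)
    rw [pow_succ] at h3
    omega
  | sub e f he hf => exact (Nat.sub_le _ _).trans_lt he
  | mul e f he hf =>
    simp only [Expr.eval, Expr.width]
    rw [add_mul, pow_add]
    exact Nat.mul_lt_mul'' he hf
  | lt e f _ _ =>
    simp only [Expr.eval, Expr.width, one_mul]
    have : 2 ^ 1 ≤ 2 ^ W := Nat.pow_le_pow_right two_pos hW
    split_ifs <;> omega

theorem Expr.cost_le {W : ℕ} (hW : 1 ≤ W) {s : State} (h : Bdd W s) (e : Expr) :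
    e.cost s ≤ e.weight * W := by
  have hsize : ∀ e : Expr, (e.eval s).size ≤ e.width * W := fun e =>
    Nat.size_le.2 (e.eval_lt hW h)
  induction e with
  | lit k => exact Nat.le_mul_of_pos_right _ hW
  | var x =>
    have := hsize (.var x)
    simp only [Expr.cost, Expr.weight, Expr.eval, Expr.width] at this ⊢
    omega
  | read a i hi =>
    have := hsize (.read a i)
    simp only [Expr.cost, Expr.weight, Expr.eval, Expr.width, add_mul] at this ⊢
    omega
  | add e f he hf =>
    have := hsize (.add e f)
    simp only [Expr.cost, Expr.weight, Expr.eval, Expr.width, add_mul] at this ⊢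
    omega
  | sub e f he hf =>
    have := hsize (.sub e f)
    simp only [Expr.cost, Expr.weight, Expr.eval, Expr.width, add_mul] at this ⊢
    omega
  | mul e f he hf =>
    have := hsize (.mul e f)
    simp only [Expr.cost, Expr.weight, Expr.eval, Expr.width, add_mul] at this ⊢
    omega
  | lt e f he hf =>
    simp only [Expr.cost, Expr.weight, add_mul]
    omega

theorem Expr.cost_add_one_le {W C : ℕ} (hW : 1 ≤ W) {s : State} (h : Bdd W s) (e : Expr)
    (hC : e.weight + 1 ≤ C) : e.cost s + 1 ≤ C * W := by
  have h1 := e.cost_le hW h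
  have h2 := Nat.mul_le_mul_right W hC
  rw [add_mul] at h2
  omega

theorem Runs.assign {W C : ℕ} (hW : 1 ≤ W) {s : State} (hs : Bdd W s) (x : ℕ) (e : Expr)
    (hC : e.weight + 1 ≤ C) {Q : State → Prop} (hQ : Q (s.setVar x (e.eval s))) :
    Runs (.assign x e) s (C * W) Q := by
  exact ⟨_, _, .assign s x e, e.cost_add_one_le hW hs hC, hQ⟩

theorem Runs.write {W C : ℕ} (hW : 1 ≤ W) {s : State} (hs : Bdd W s) (a : ℕ) (i e : Expr)
    (hC : i.weight + e.weight + 1 ≤ C) {Q : State → Prop}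
    (hQ : Q (s.setArr a (i.eval s) (e.eval s))) : Runs (.write a i e) s (C * W) Q := by
  refine ⟨_, _, .write s a i e, ?_, hQ⟩
  have h1 := e.cost_le hW hs
  have h2 := i.cost_le hW hs
  have h3 := Nat.mul_le_mul_right W hC
  rw [add_mul, add_mul] at h3
  omega

theorem length_le_bitLength (l : List ℕ) : l.length ≤ bitLength l := by
  induction l with
  | nil => simp
  | cons a l ih => simp only [bitLength, List.length_cons, List.map_cons, List.sum_cons] at *; omega

/-- The separating symbol of each entry supplies the factor two for one addition. Thus the running
total of the chips fits into as many bits as the input. -/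
theorem sum_lt_two_pow_bitLength (l : List ℕ) : l.sum < 2 ^ bitLength l := by
  induction l with
  | nil => simp [bitLength]
  | cons a l ih =>
    have h1 := Nat.lt_size_self a
    have h2 : 2 ^ a.size ≤ 2 ^ (a.size + bitLength l) := Nat.pow_le_pow_right two_pos (by omega)
    have h3 : 2 ^ bitLength l ≤ 2 ^ (a.size + bitLength l) :=
      Nat.pow_le_pow_right two_pos (by omega)
    have h4 : bitLength (a :: l) = a.size + bitLength l + 1 := by
      simp [bitLength]; ring
    rw [h4, pow_succ, List.sum_cons]
    omega

theorem getD_lt_two_pow_bitLength (l : List ℕ) (i : ℕ) : l.getD i 0 < 2 ^ bitLength l := by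
  by_cases hi : i < l.length
  · rw [List.getD_eq_getElem _ _ hi]
    exact (List.le_sum_of_mem (List.getElem_mem hi)).trans_lt (sum_lt_two_pow_bitLength l)
  · rw [List.getD_eq_default _ _ (by omega)]
    positivity

theorem bdd_initial (l : List ℕ) : Bdd (bitLength l) (initial l) := by
  constructor
  · intro x
    simp only [initial]
    split_ifs
    · exact (length_le_bitLength l).trans_lt Nat.lt_two_pow_self
    · positivity
  · intro a i
    simp only [initial]
    split_ifs
    · exact getD_lt_two_pow_bitLength l i
    · positivity

theorem sum_range_getD (l : List ℕ) (j k : ℕ) :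
    ∑ i ∈ Finset.range k, l.getD (j + i) 0 = ((l.drop j).take k).sum := by
  induction k with
  | zero => simp
  | succ k ih =>
    rw [Finset.sum_range_succ, ih, List.take_add_one, List.sum_append, List.getElem?_drop,
      List.getD_eq_getElem?_getD]
    cases l[j + k]? <;> simp

theorem sum_range_getD_lt (l : List ℕ) (j k : ℕ) :
    ∑ i ∈ Finset.range k, l.getD (j + i) 0 < 2 ^ bitLength l := by
  rw [sum_range_getD]
  exact (((List.take_sublist _ _).trans (List.drop_sublist _ _)).sum_le_sum
    (fun _ _ => Nat.zero_le _)).trans_lt (sum_lt_two_pow_bitLength l)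

end RAM

/-! ### The layout of the input -/

section Layout

variable (r : ℕ) {n m : ℕ} (G : Multigraph (Fin n) (Fin m))
  (D : Divisor (AuxVertex (Fin n) (Fin m)))

theorem List.getD_append_length_add {α : Type*} (l l' : List α) {i j : ℕ} (d : α)
    (h : i = l.length + j) : (l ++ l').getD i d = l'.getD j d := by
  subst h
  rw [List.getD_append_right _ _ _ _ (by omega), Nat.add_sub_cancel_left]

theorem List.getD_ofFn_append {α : Type*} {k : ℕ} (f : Fin k → α) (l : List α) {i : ℕ}
    (hi : i < k) (d : α) : (List.ofFn f ++ l).getD i d = f ⟨i, hi⟩ := by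
  rw [List.getD_append _ _ _ _ (by simpa), List.getD_eq_getElem _ _ (by simpa),
    List.getElem_ofFn]

theorem length_encodeInstance : (encodeInstance r G D).length = 3 * n + 4 * m + 4 := by
  simp [encodeInstance]
  ring

theorem encodeInstance_zero : (encodeInstance r G D).getD 0 0 = r := by
  simp [encodeInstance]

theorem encodeInstance_one : (encodeInstance r G D).getD 1 0 = n := by
  simp [encodeInstance]

theorem encodeInstance_two : (encodeInstance r G D).getD 2 0 = m := by
  simp [encodeInstance]

theorem encodeInstance_ends_false {e : ℕ} (he : e < m) :
    (encodeInstance r G D).getD (3 + e) 0 = G.ends ⟨e, he⟩ false := by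
  simp only [encodeInstance, List.append_assoc]
  rw [List.getD_append_length_add _ _ _ (j := e) (by simp), List.getD_ofFn_append _ _ he]

theorem encodeInstance_ends_true {e : ℕ} (he : e < m) :
    (encodeInstance r G D).getD (3 + m + e) 0 = G.ends ⟨e, he⟩ true := by
  simp only [encodeInstance, List.append_assoc]
  rw [List.getD_append_length_add _ _ _ (j := m + e) (by simp; ring),
    List.getD_append_length_add _ _ _ (j := e) (by simp), List.getD_ofFn_append _ _ he]

theorem encodeInstance_prime {v : ℕ} (hv : v < n) :
    (encodeInstance r G D).getD (4 + 2 * m + n + v) 0 = (D (.prime ⟨v, hv⟩)).toNat := by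
  simp only [encodeInstance, List.append_assoc]
  rw [List.getD_append_length_add _ _ _ (j := 1 + 2 * m + n + v) (by simp; ring),
    List.getD_append_length_add _ _ _ (j := 1 + m + n + v) (by simp; ring),
    List.getD_append_length_add _ _ _ (j := 1 + n + v) (by simp; ring),
    List.getD_append_length_add _ _ _ (j := n + v) (by simp; ring),
    List.getD_append_length_add _ _ _ (j := v) (by simp), List.getD_ofFn_append _ _ hv]

theorem encodeInstance_tip {v : ℕ} (hv : v < n) :
    (encodeInstance r G D).getD (4 + 2 * m + 2 * n + v) 0 = (D (.tip ⟨v, hv⟩)).toNat := by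
  simp only [encodeInstance, List.append_assoc]
  rw [List.getD_append_length_add _ _ _ (j := 1 + 2 * m + 2 * n + v) (by simp; ring),
    List.getD_append_length_add _ _ _ (j := 1 + m + 2 * n + v) (by simp; ring),
    List.getD_append_length_add _ _ _ (j := 1 + 2 * n + v) (by simp; ring),
    List.getD_append_length_add _ _ _ (j := 2 * n + v) (by simp; ring),
    List.getD_append_length_add _ _ _ (j := n + v) (by simp; ring),
    List.getD_append_length_add _ _ _ (j := v) (by simp), List.getD_ofFn_append _ _ hv]

theorem sum_encodeInstance (hD : D.Effective) :
    ((∑ i ∈ Finset.range (3 * n + 2 * m + 1),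
      (encodeInstance r G D).getD (3 + 2 * m + i) 0 : ℕ) : ℤ) = D.deg := by
  rw [RAM.sum_range_getD, List.take_of_length_le (by
    rw [List.length_drop, length_encodeInstance]; omega)]
  simp only [encodeInstance, List.append_assoc]
  -- The header and the two endpoint lists are regrouped into the prefix that is dropped.
  rw [← List.append_assoc, ← List.append_assoc, List.drop_left' (by simp; ring), Divisor.deg,
    AuxVertex.sum_eq]
  simp only [List.sum_append, List.sum_ofFn, List.sum_singleton]
  push_cast
  simp only [Int.toNat_of_nonneg (hD _)]
  ring

end Layout

/-! ### The program and its correctness. -/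

namespace RAM

/-- The number of the first input cell that holds a chip count. -/
def chipOffset : Expr := .add (.lit 3) (.mul (.lit 2) (.read 0 (.lit 2)))

/-- Sum up the chips. -/
def sumLoop : Prog :=
  .while (.lt (.var 2) (.var 0))
    (.seq (.assign 3 (.add (.var 3) (.read 0 (.var 2)))) (.assign 2 (.add (.var 2) (.lit 1))))

/-- Decide whether the degree is at least `bundleSize`. -/
def degreeTest : Prog :=
  -- The difference counts the chip cells, `3n + 2m + 1`; its product with `r` is `M - 1`, so the
  -- strict comparison tests `M ≤ deg D`.
  .assign 4 (.lt (.mul (.read 0 (.lit 0)) (.sub (.var 0) chipOffset)) (.var 3))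

/-- The number of chips on `v'` and `T_v`, where `v` is the current vertex. -/
def pairSum : Expr :=
  .add (.read 0 (.add (.add (.add (.lit 4) (.mul (.lit 2) (.read 0 (.lit 2))))
      (.read 0 (.lit 1))) (.var 1)))
    (.read 0 (.add (.add (.add (.lit 4) (.mul (.lit 2) (.read 0 (.lit 2))))
      (.mul (.lit 2) (.read 0 (.lit 1)))) (.var 1)))

/-- Write the indicator vector of the candidates. -/
def candidateLoop : Prog :=
  .while (.lt (.var 1) (.read 0 (.lit 1)))
    (.seq
      -- The sum of two truth values is their disjunction; comparing with `0` makes it `0` or `1`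
      -- again. Variable `1`, the vertex counter, ends at `n` and so serves as the output length.
      (.write 1 (.var 1) (.lt (.lit 0) (.add (.var 4)
        (.lt pairSum (.add (.mul (.lit 2) (.read 0 (.lit 0))) (.lit 1))))))
      (.assign 1 (.add (.var 1) (.lit 1))))

/-- One endpoint of the current edge. -/
def endFalse : Expr := .read 0 (.add (.lit 3) (.var 5))

/-- The other endpoint of the current edge. -/
def endTrue : Expr := .read 0 (.add (.add (.lit 3) (.read 0 (.lit 2))) (.var 5))

/-- Remove one endpoint of every edge that has both endpoints in the current set. -/
def pruneLoop : Prog :=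
  .while (.lt (.var 5) (.read 0 (.lit 2)))
    (.seq
      -- The product of the two indicators is their conjunction.
      (.ite (.mul (.read 1 endFalse) (.read 1 endTrue)) (.write 1 endFalse (.lit 0)) .skip)
      (.assign 5 (.add (.var 5) (.lit 1))))

/-- The program that constructs the independent set. -/
def indepProg : Prog :=
  .seq (.assign 2 chipOffset) (.seq sumLoop (.seq degreeTest (.seq candidateLoop pruneLoop)))

section Correctness

variable {r n m : ℕ} {G : Multigraph (Fin n) (Fin m)} {D : Divisor (AuxVertex (Fin n) (Fin m))}

/-- The input is intact, and all numbers are small. -/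
structure Intact (r : ℕ) (G : Multigraph (Fin n) (Fin m))
    (D : Divisor (AuxVertex (Fin n) (Fin m))) (s : State) : Prop where
  bdd : Bdd (bitLength (encodeInstance r G D)) s
  input : ∀ i, s.arr 0 i = (encodeInstance r G D).getD i 0

theorem Intact.setVar {s : State} (h : Intact r G D s) (x : ℕ) {k : ℕ}
    (hk : k < 2 ^ bitLength (encodeInstance r G D)) : Intact r G D (s.setVar x k) :=
  ⟨h.bdd.setVar x hk, h.input⟩

theorem Intact.setArr {s : State} (h : Intact r G D s) (i : ℕ) {k : ℕ}
    (hk : k < 2 ^ bitLength (encodeInstance r G D)) : Intact r G D (s.setArr 1 i k) :=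
  ⟨h.bdd.setArr 1 i hk, fun j => by simpa [State.setArr] using h.input j⟩

theorem card_le_bitLength : 3 * n + 4 * m + 4 ≤ bitLength (encodeInstance r G D) :=
  (length_encodeInstance r G D).symm.trans_le (length_le_bitLength _)

theorem one_le_bitLength : 1 ≤ bitLength (encodeInstance r G D) := by
  have := card_le_bitLength (r := r) (G := G) (D := D)
  omega

theorem lt_two_pow {k : ℕ} (hk : k ≤ 3 * n + 4 * m + 4) :
    k < 2 ^ bitLength (encodeInstance r G D) :=
  (hk.trans card_le_bitLength).trans_lt Nat.lt_two_pow_self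

theorem size_two : Nat.size 2 = 2 := rfl
theorem size_three : Nat.size 3 = 2 := rfl
theorem size_four : Nat.size 4 = 3 := rfl

/-- Here and below, `200` times the bit length is a generous common bound for any single test or
assignment. Variables `1` and `5` are carried along because later loops count from their initial
value zero. -/
theorem runs_sumLoop (hD : D.Effective) {s : State} (hs : Intact r G D s)
    (h0 : s.var 0 = 3 * n + 4 * m + 4) (h1 : s.var 1 = 0) (h2 : s.var 2 = 3 + 2 * m)
    (h3 : s.var 3 = 0) (h5 : s.var 5 = 0) :
    Runs sumLoop s ((3 * n + 2 * m + 1) * (200 * bitLength (encodeInstance r G D) +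
      (200 * bitLength (encodeInstance r G D) + 200 * bitLength (encodeInstance r G D))) +
      200 * bitLength (encodeInstance r G D)) fun s =>
        Intact r G D s ∧ s.var 0 = 3 * n + 4 * m + 4 ∧ s.var 1 = 0 ∧ (s.var 3 : ℤ) = D.deg ∧
          s.var 5 = 0 := by
  refine (Runs.while (fun k s => Intact r G D s ∧ s.var 0 = 3 * n + 4 * m + 4 ∧ s.var 1 = 0 ∧
    s.var 2 = 3 + 2 * m + k ∧
    s.var 3 = ∑ i ∈ Finset.range k, (encodeInstance r G D).getD (3 + 2 * m + i) 0 ∧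
    s.var 5 = 0) ?_ ?_ ?_ ?_).mono le_rfl ?_
  · rintro k s ⟨hs, -⟩
    exact Expr.cost_add_one_le one_le_bitLength hs.bdd _ (by simp [Expr.weight])
  · rintro s ⟨hs, h0, h1, h2, -⟩
    simp [Expr.eval, h0, h2]
    omega
  · rintro k s hk ⟨hs, h0, h1, h2, h3, h5⟩
    refine ⟨by simp [Expr.eval, h0, h2]; omega, ?_⟩
    have hsum := sum_range_getD_lt (encodeInstance r G D) (3 + 2 * m) (k + 1)
    rw [Finset.sum_range_succ] at hsum
    have hval : s.var 3 + s.arr 0 (s.var 2) < 2 ^ bitLength (encodeInstance r G D) := by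
      rwa [hs.input, h3, h2]
    refine Runs.seq (Runs.assign one_le_bitLength hs.bdd _ _ (by simp [Expr.weight, Expr.width])
      (Q := fun s => Intact r G D s ∧ s.var 0 = 3 * n + 4 * m + 4 ∧ s.var 1 = 0 ∧
        s.var 2 = 3 + 2 * m + k ∧
        s.var 3 = ∑ i ∈ Finset.range (k + 1), (encodeInstance r G D).getD (3 + 2 * m + i) 0 ∧
        s.var 5 = 0) ⟨hs.setVar _ hval, ?_⟩) ?_
    · simp [State.setVar, Expr.eval, h0, h1, h2, h3, h5, hs.input, Finset.sum_range_succ]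
    · rintro s ⟨hs, h0, h1, h2, h3, h5⟩
      refine Runs.assign one_le_bitLength hs.bdd _ _
        (by simp [Expr.weight, Expr.width]) ⟨hs.setVar _ (lt_two_pow ?_), ?_⟩
      · simp only [Expr.eval, h2]; omega
      · simp [State.setVar, Expr.eval, h0, h1, h2, h3, h5, add_assoc]
  · exact ⟨hs, h0, h1, h2, by simpa using h3, h5⟩
  · rintro s ⟨hs, h0, h1, h2, h3, h5⟩
    refine ⟨hs, h0, h1, ?_, h5⟩
    rw [h3, sum_encodeInstance r G D hD]

theorem runs_degreeTest {s : State} (hs : Intact r G D s)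
    (h0 : s.var 0 = 3 * n + 4 * m + 4) (h1 : s.var 1 = 0) (h3 : (s.var 3 : ℤ) = D.deg)
    (h5 : s.var 5 = 0) :
    Runs degreeTest s (200 * bitLength (encodeInstance r G D)) fun s =>
      Intact r G D s ∧ s.var 1 = 0 ∧
      (s.var 4 = if (Multigraph.bundleSize (Fin n) (Fin m) r : ℤ) ≤ D.deg then 1 else 0) ∧
      s.var 5 = 0 := by
  have hval : (Expr.lt (.mul (.read 0 (.lit 0)) (.sub (.var 0) chipOffset)) (.var 3)).eval s =
      if (Multigraph.bundleSize (Fin n) (Fin m) r : ℤ) ≤ D.deg then 1 else 0 := by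
    have h : 3 * n + 4 * m + 4 - (3 + 2 * m) = 3 * n + 2 * m + 1 := by omega
    simp only [Expr.eval, chipOffset, hs.input, encodeInstance_zero, encodeInstance_two, h0, h,
      ← h3, Multigraph.bundleSize, Fintype.card_fin]
    congr 1
    norm_cast
  refine Runs.assign one_le_bitLength hs.bdd _ _
    (by simp [Expr.weight, Expr.width, chipOffset, size_two, size_three])
    ⟨hs.setVar _ (lt_two_pow ?_), ?_⟩
  · rw [hval]; split_ifs <;> omega
  · rw [hval]; simp [State.setVar, h1, h5]

theorem runs_candidateLoop (hD : D.Effective) {s : State} (hs : Intact r G D s)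
    (h1 : s.var 1 = 0)
    (h4 : s.var 4 = if (Multigraph.bundleSize (Fin n) (Fin m) r : ℤ) ≤ D.deg then 1 else 0)
    (h5 : s.var 5 = 0) :
    Runs candidateLoop s (n * (200 * bitLength (encodeInstance r G D) +
      (200 * bitLength (encodeInstance r G D) + 200 * bitLength (encodeInstance r G D))) +
      200 * bitLength (encodeInstance r G D)) fun s =>
        Intact r G D s ∧ s.var 1 = n ∧ s.var 5 = 0 ∧
          ∀ v : Fin n, s.arr 1 v = if v ∈ Multigraph.candidates r D then 1 else 0 := by
  refine (Runs.while (fun k s => Intact r G D s ∧ s.var 1 = k ∧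
    (s.var 4 = if (Multigraph.bundleSize (Fin n) (Fin m) r : ℤ) ≤ D.deg then 1 else 0) ∧
    s.var 5 = 0 ∧
    ∀ v : Fin n, (v : ℕ) < k → s.arr 1 v = if v ∈ Multigraph.candidates r D then 1 else 0)
    ?_ ?_ ?_ ?_).mono le_rfl ?_
  · rintro k s ⟨hs, -⟩
    exact Expr.cost_add_one_le one_le_bitLength hs.bdd _ (by simp [Expr.weight])
  · rintro s ⟨hs, h1, -⟩
    simp [Expr.eval, h1, hs.input, encodeInstance_one, -List.getD_eq_getElem?_getD]
  · rintro k s hk ⟨hs, h1, h4, h5, hA⟩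
    refine ⟨by
      simp [Expr.eval, h1, hs.input, encodeInstance_one, hk, -List.getD_eq_getElem?_getD], ?_⟩
    have hval : (Expr.lt (.lit 0) (.add (.var 4) (.lt pairSum
        (.add (.mul (.lit 2) (.read 0 (.lit 0))) (.lit 1))))).eval s =
        if (⟨k, hk⟩ : Fin n) ∈ Multigraph.candidates r D then 1 else 0 := by
      have hp := hD (.prime ⟨k, hk⟩)
      have ht := hD (.tip ⟨k, hk⟩)
      simp only [Expr.eval, pairSum, hs.input, encodeInstance_zero, encodeInstance_one,
        encodeInstance_two, h1, h4, encodeInstance_prime r G D hk, encodeInstance_tip r G D hk,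
        Multigraph.candidates, Finset.mem_filter, Finset.mem_univ, true_and]
      split_ifs <;> omega
    refine Runs.seq (Runs.write one_le_bitLength hs.bdd _ _ _
      (by simp [Expr.weight, Expr.width, pairSum, size_two, size_four])
      (Q := fun s => Intact r G D s ∧ s.var 1 = k ∧
        (s.var 4 = if (Multigraph.bundleSize (Fin n) (Fin m) r : ℤ) ≤ D.deg then 1 else 0) ∧
        s.var 5 = 0 ∧ ∀ v : Fin n, (v : ℕ) < k + 1 →
          s.arr 1 v = if v ∈ Multigraph.candidates r D then 1 else 0)
      ⟨hs.setArr _ (lt_two_pow ?_), h1, h4, h5, ?_⟩) ?_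
    · rw [hval]; split_ifs <;> omega
    · intro v hv
      rw [hval]
      simp only [State.setArr, Function.update_self, Expr.eval, h1]
      by_cases hvk : (v : ℕ) = k
      · subst hvk; simp
      · rw [Function.update_of_ne hvk]
        exact hA v (by omega)
    · rintro s ⟨hs, h1, h4, h5, hA⟩
      refine Runs.assign one_le_bitLength hs.bdd _ _
        (by simp [Expr.weight, Expr.width]) ⟨hs.setVar _ (lt_two_pow ?_), ?_⟩
      · simp only [Expr.eval, h1]; omega
      · refine ⟨by simp [State.setVar, Expr.eval, h1], ?_, ?_, hA⟩
        · simpa [State.setVar] using h4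
        · simpa [State.setVar] using h5
  · exact ⟨hs, h1, h4, h5, fun v hv => absurd hv (by omega)⟩
  · rintro s ⟨hs, h1, -, h5, hA⟩
    exact ⟨hs, h1, h5, fun v => hA v v.isLt⟩

/-- Every removal is charged to the current edge, which lies inside the current set and hence inside
`A`. Edges already treated stay harmless because the set only shrinks. -/
theorem runs_pruneLoop {A : Finset (Fin n)} {s : State} (hs : Intact r G D s)
    (h1 : s.var 1 = n) (h5 : s.var 5 = 0)
    (hA : ∀ v : Fin n, s.arr 1 v = if v ∈ A then 1 else 0) :
    Runs pruneLoop s (m * (200 * bitLength (encodeInstance r G D) +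
      (200 * bitLength (encodeInstance r G D) + 200 * bitLength (encodeInstance r G D) +
        200 * bitLength (encodeInstance r G D))) +
      200 * bitLength (encodeInstance r G D)) fun s =>
        s.var 1 = n ∧ ∃ S : Finset (Fin n),
          (∀ v : Fin n, s.arr 1 v = if v ∈ S then 1 else 0) ∧
          (∀ e, ¬ (G.ends e false ∈ S ∧ G.ends e true ∈ S)) ∧
          A.card ≤ S.card + (Finset.univ.filter fun e =>
            G.ends e false ∈ A ∧ G.ends e true ∈ A).card := by
  refine (Runs.while (fun k s => Intact r G D s ∧ s.var 1 = n ∧ s.var 5 = k ∧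
    ∃ S : Finset (Fin n), S ⊆ A ∧ (∀ v : Fin n, s.arr 1 v = if v ∈ S then 1 else 0) ∧
      (∀ e : Fin m, (e : ℕ) < k → ¬ (G.ends e false ∈ S ∧ G.ends e true ∈ S)) ∧
      A.card ≤ S.card + (Finset.univ.filter fun e : Fin m =>
        (e : ℕ) < k ∧ G.ends e false ∈ A ∧ G.ends e true ∈ A).card) ?_ ?_ ?_ ?_).mono le_rfl ?_
  · rintro k s ⟨hs, -⟩
    exact Expr.cost_add_one_le one_le_bitLength hs.bdd _ (by simp [Expr.weight, size_two])
  · rintro s ⟨hs, -, h5, -⟩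
    simp [Expr.eval, h5, hs.input, encodeInstance_two, -List.getD_eq_getElem?_getD]
  · rintro k s hk ⟨hs, h1, h5, S, hSA, hS, hind, hcard⟩
    refine ⟨by
      simp [Expr.eval, h5, hs.input, encodeInstance_two, hk, -List.getD_eq_getElem?_getD], ?_⟩
    set e : Fin m := ⟨k, hk⟩ with he
    have hfalse : endFalse.eval s = (G.ends e false : ℕ) := by
      simp only [endFalse, Expr.eval, hs.input, h5, encodeInstance_ends_false r G D hk, he]
    have htrue : endTrue.eval s = (G.ends e true : ℕ) := by
      simp only [endTrue, Expr.eval, hs.input, h5, encodeInstance_two,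
        encodeInstance_ends_true r G D hk, he]
    have hcond : (Expr.mul (.read 1 endFalse) (.read 1 endTrue)).eval s =
        if G.ends e false ∈ S ∧ G.ends e true ∈ S then 1 else 0 := by
      simp only [Expr.eval, hfalse, htrue, hS]
      split_ifs <;> simp_all
    refine Runs.seq (Runs.ite (C := 200 * bitLength (encodeInstance r G D))
      (B := 200 * bitLength (encodeInstance r G D))
      (Q := fun s => Intact r G D s ∧ s.var 1 = n ∧ s.var 5 = k ∧
        ∃ S : Finset (Fin n), S ⊆ A ∧ (∀ v : Fin n, s.arr 1 v = if v ∈ S then 1 else 0) ∧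
          (∀ e : Fin m, (e : ℕ) < k + 1 → ¬ (G.ends e false ∈ S ∧ G.ends e true ∈ S)) ∧
          A.card ≤ S.card + (Finset.univ.filter fun e : Fin m =>
            (e : ℕ) < k + 1 ∧ G.ends e false ∈ A ∧ G.ends e true ∈ A).card) ?_ ?_ ?_) ?_
    · exact Expr.cost_add_one_le one_le_bitLength hs.bdd _
        (by simp [Expr.weight, Expr.width, endFalse, endTrue, size_two, size_three])
    · intro hne
      have hmem : G.ends e false ∈ S ∧ G.ends e true ∈ S := by
        by_contra h
        rw [hcond, if_neg h] at hne
        exact hne rfl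
      refine Runs.write one_le_bitLength hs.bdd _ _ _
        (by simp [Expr.weight, Expr.width, endFalse, size_three])
        ⟨hs.setArr _ (lt_two_pow (Nat.zero_le _)), h1, h5, S.erase (G.ends e false),
          (Finset.erase_subset _ _).trans hSA, ?_, ?_, ?_⟩
      · intro v
        simp only [State.setArr, Function.update_self, hfalse, Expr.eval]
        by_cases hv : v = G.ends e false
        · subst hv; simp
        · rw [Function.update_of_ne (fun h => hv (Fin.ext h)), hS]
          simp [hv]
      · rintro e' he' ⟨ha, hb⟩
        by_cases hek : e' = e
        · subst hek; simp at ha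
        · exact hind e' (by have : (e' : ℕ) ≠ k := fun h => hek (Fin.ext h); omega)
            ⟨Finset.mem_of_mem_erase ha, Finset.mem_of_mem_erase hb⟩
      -- The current edge enters the count exactly when a vertex is lost.
      · have hlt : (Finset.univ.filter fun e : Fin m =>
            (e : ℕ) < k ∧ G.ends e false ∈ A ∧ G.ends e true ∈ A).card <
            (Finset.univ.filter fun e : Fin m =>
              (e : ℕ) < k + 1 ∧ G.ends e false ∈ A ∧ G.ends e true ∈ A).card := by
          refine Finset.card_lt_card (Finset.ssubset_iff_of_subset ?_ |>.2 ⟨e, ?_, ?_⟩)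
          · intro e' he'
            simp only [Finset.mem_filter, Finset.mem_univ, true_and] at he' ⊢
            exact ⟨by omega, he'.2⟩
          · exact Finset.mem_filter.2
              ⟨Finset.mem_univ _, Nat.lt_succ_self k, hSA hmem.1, hSA hmem.2⟩
          · simp [he]
        rw [Finset.card_erase_of_mem hmem.1]
        omega
    · intro hz
      have hmem : ¬ (G.ends e false ∈ S ∧ G.ends e true ∈ S) := by
        intro h
        rw [hcond, if_pos h] at hz
        exact one_ne_zero hz
      refine ⟨s, 1, .skip s, ?_, hs, h1, h5, S, hSA, hS, ?_, hcard.trans ?_⟩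
      · have := one_le_bitLength (r := r) (G := G) (D := D)
        omega
      · intro e' he'
        by_cases hek : e' = e
        · subst hek; exact hmem
        · exact hind e' (by have : (e' : ℕ) ≠ k := fun h => hek (Fin.ext h); omega)
      · refine Nat.add_le_add_left (Finset.card_le_card fun e' he' => ?_) _
        simp only [Finset.mem_filter, Finset.mem_univ, true_and] at he' ⊢
        exact ⟨by omega, he'.2⟩
    · rintro s ⟨hs, h1, h5, hrest⟩
      refine Runs.assign one_le_bitLength hs.bdd _ _
        (by simp [Expr.weight, Expr.width]) ⟨hs.setVar _ (lt_two_pow ?_), ?_, ?_, hrest⟩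
      · simp only [Expr.eval, h5]; omega
      · simpa [State.setVar] using h1
      · simp [State.setVar, Expr.eval, h5]
  · exact ⟨hs, h1, h5, A, subset_rfl, hA, fun e he => absurd he (by omega), by simp⟩
  · rintro s ⟨-, h1, -, S, -, hS, hind, hcard⟩
    exact ⟨h1, S, hS, fun e => hind e e.isLt, by simpa using hcard⟩

theorem indepProg_computes (hD : D.Effective) : ∃ (S : Finset (Fin n)) (t : ℕ),
    indepProg.Computes (encodeInstance r G D) (encodeVertexSet S) t ∧
    t ≤ 3000 * bitLength (encodeInstance r G D) ^ 2 ∧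
    (∀ e, ¬ (G.ends e false ∈ S ∧ G.ends e true ∈ S)) ∧
    (Multigraph.candidates r D).card ≤ S.card + (Finset.univ.filter fun e =>
      G.ends e false ∈ Multigraph.candidates r D ∧
        G.ends e true ∈ Multigraph.candidates r D).card := by
  have hinit : Intact r G D (initial (encodeInstance r G D)) :=
    ⟨bdd_initial _, fun i => by simp [initial]⟩
  have hoff : chipOffset.eval (initial (encodeInstance r G D)) = 3 + 2 * m := by
    simp only [chipOffset, Expr.eval, hinit.input, encodeInstance_two]
  have hstart : Runs (.assign 2 chipOffset) (initial (encodeInstance r G D))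
      (200 * bitLength (encodeInstance r G D)) fun s => Intact r G D s ∧
        s.var 0 = 3 * n + 4 * m + 4 ∧ s.var 1 = 0 ∧ s.var 2 = 3 + 2 * m ∧ s.var 3 = 0 ∧
        s.var 5 = 0 := by
    refine Runs.assign one_le_bitLength hinit.bdd _ _
      (by simp [Expr.weight, Expr.width, chipOffset, size_two, size_three])
      ⟨hinit.setVar _ (lt_two_pow (by rw [hoff]; omega)), ?_⟩
    rw [hoff]
    simp [State.setVar, initial, length_encodeInstance]
  obtain ⟨s, t, hexec, ht, h1, S, hS, hind, hcard⟩ :=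
    hstart.seq fun s ⟨hs, h0, h1, h2, h3, h5⟩ =>
    (runs_sumLoop hD hs h0 h1 h2 h3 h5).seq fun s ⟨hs, h0, h1, h3, h5⟩ =>
    (runs_degreeTest hs h0 h1 h3 h5).seq fun s ⟨hs, h1, h4, h5⟩ =>
    (runs_candidateLoop hD hs h1 h4 h5).seq fun s ⟨hs, h1, h5, hA⟩ =>
    runs_pruneLoop hs h1 h5 hA
  refine ⟨S, t, ⟨s, hexec, ?_⟩, ?_, hind, hcard⟩
  · rw [State.output, h1, encodeVertexSet]
    refine List.ext_getElem (by simp) fun i hi _ => ?_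
    simp only [List.length_map, List.length_range] at hi
    simpa using hS ⟨i, hi⟩
  · have hW := card_le_bitLength (r := r) (G := G) (D := D)
    refine ht.trans ?_
    generalize bitLength (encodeInstance r G D) = W at hW
    -- The loops make `4n + 3m + 1` passes of cost linear in `W`, and the number of input cells is
    -- at most `W`.
    have h : (3 * n + 4 * m + 4) * W ≤ W * W := Nat.mul_le_mul_right W hW
    have hn : 0 ≤ n * W := Nat.zero_le _
    have hm : 0 ≤ m * W := Nat.zero_le _
    nlinarith

end Correctness

end RAM

/-! ### The approximation ratio. -/

namespace Multigraph

/-- Adding the two bounds gives `c ≥ a - (d - g) ≥ a - ε * g`, so it remains to bound `g` by a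
multiple of `a`. -/
theorem bound_of_le_dgon {n m r a c : ℕ} {d g : ℤ} {ε : ℝ} (hr : 1 ≤ r) (hna : n ≤ 4 * a)
    (hmn : 2 * m ≤ 3 * n) (hg : (r : ℤ) ≤ g) (hgd : g ≤ d) (hd : (d : ℝ) ≤ (1 + ε) * g)
    (hga : g ≤ (3 * r + 1) * n + (2 * r - 1) * m + r - a)
    (hc : ((3 * r + 1) * n + (2 * r - 1) * m + r - d : ℤ) ≤ c) :
    (1 - (25 * (r : ℝ) - 3) * ε) * (a : ℝ) ≤ c := by
  have hr' : (1 : ℝ) ≤ r := by exact_mod_cast hr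
  have hg' : (r : ℝ) ≤ g := by exact_mod_cast hg
  have hgd' : (g : ℝ) ≤ d := by exact_mod_cast hgd
  have hna' : (n : ℝ) ≤ 4 * a := by exact_mod_cast hna
  have hmn' : 2 * (m : ℝ) ≤ 3 * n := by exact_mod_cast hmn
  have hga' : (g : ℝ) ≤ (3 * r + 1) * n + (2 * r - 1) * m + r - a := by exact_mod_cast hga
  have hc' : (3 * r + 1) * n + (2 * r - 1) * m + r - d ≤ (c : ℝ) := by exact_mod_cast hc
  rcases Nat.eq_zero_or_pos a with rfl | ha
  · simp
  have ha' : (1 : ℝ) ≤ a := by exact_mod_cast ha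
  -- A negative `ε` would contradict `0 < g ≤ d`.
  have hε : 0 ≤ ε := by
    by_contra! h
    nlinarith
  -- From `m ≤ 3n/2`, then `n ≤ 4a` and `r ≤ r * a`: `g ≤ (6r - 1/2)n + r - a ≤ (24r - 2)a + r * a -
  -- a`.
  have hga2 : (g : ℝ) ≤ (25 * r - 3) * a := by
    have h1 : (2 * (r : ℝ) - 1) * (2 * m) ≤ (2 * r - 1) * (3 * n) :=
      mul_le_mul_of_nonneg_left hmn' (by linarith)
    have h2 : (12 * (r : ℝ) - 1) * n ≤ (12 * r - 1) * (4 * a) :=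
      mul_le_mul_of_nonneg_left hna' (by linarith)
    have h3 : (r : ℝ) * 1 ≤ r * a := mul_le_mul_of_nonneg_left ha' (by linarith)
    linarith
  have h4 : ε * g ≤ ε * ((25 * r - 3) * a) := mul_le_mul_of_nonneg_left hga2 hε
  linarith

end Multigraph

theorem mainTheorem9 :
    ∃ (P : RAM.Prog) (p : Polynomial ℕ),
      ∀ (r : ℕ), 1 ≤ r →
      ∀ (n m : ℕ) (G : Multigraph (Fin n) (Fin m)), G.IsSubcubic →
      ∀ (D : Divisor (AuxVertex (Fin n) (Fin m))),
        D.Effective → (r : ℤ) ≤ (G.aux r).rank D →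
      ∀ (ε : ℝ), (D.deg : ℝ) ≤ (1 + ε) * ((G.aux r).dgon r : ℝ) →
      ∃ (S : Finset (Fin n)) (t : ℕ),
        P.Computes (encodeInstance r G D) (encodeVertexSet S) t ∧
        t ≤ p.eval (r + RAM.bitLength (encodeInstance r G D)) ∧
        G.IsIndependent S ∧
        (1 - (25 * (r : ℝ) - 3) * ε) * (G.indepNumber : ℝ) ≤ (S.card : ℝ) := by
  refine ⟨RAM.indepProg, Polynomial.C 3000 * Polynomial.X ^ 2, ?_⟩
  intro r hr n m G hG D hD hrank ε hε
  rw [Multigraph.le_rank_iff] at hrank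
  obtain ⟨S, t, hcomp, ht, hind, hcard⟩ := RAM.indepProg_computes (r := r) (G := G) hD
  refine ⟨S, t, hcomp, ht.trans ?_, Multigraph.isIndependent_iff.2 hind, ?_⟩
  · simp only [Polynomial.eval_mul, Polynomial.eval_C, Polynomial.eval_pow, Polynomial.eval_X]
    gcongr
    omega
  · have h1 := Multigraph.le_card_candidates hD hrank
    have h2 := Multigraph.dgon_aux_le G hr
    have h3 := hG.card_le_four_mul
    have h4 := hG.two_mul_card_le
    simp only [Fintype.card_fin] at h1 h2 h3 h4
    exact Multigraph.bound_of_le_dgon hr h3 h4 hrank.le_dgon hrank.dgon_le_deg hε h2 (by omega)
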